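/- Let $\mathbb K$ be a field of characteristic zero, $V$ a $\mathbb K$-vector space of finite dimension $r\ge 1$, $U=V^*$, and let $X=(x_1,\dots,x_N)$ be a finite sequence of vectors spanning $U$. Subsequences of $X$ (identified with subsets of the index set) carry the rank $\operatorname{rk}(Y)=\dim\operatorname{span}(Y)$ and the closure $\operatorname{clos}(Y)=\{x\in X:\operatorname{rk}(Y\cup x)=\operatorname{rk}(Y)\}$; a flat is a subsequence equal to its closure, $\mathcal L(X)$ is the set of flats ordered by inclusion, and a hyperplane is a flat of rank $r-1$. Let $k\ge -1$ be an integer and let $J\subseteq\mathcal L(X)$ be a non-empty upper set; if $k=-1$, assume in addition that $J$ contains all hyperplanes. A maximal missing flat is a flat that is maximal among those not in $J$. For a flat $C$ put $m(C)=|X\setminus C|$ and $\chi(C)=1$ if $C\in J$, $\chi(C)=0$ otherwise; for $A\subseteq X$ put $\chi(A)=\chi(\operatorname{clos}(A))$; for $\eta\in V$ put $m(\eta)=m(C_\eta)$, $\chi(\eta)=\chi(C_\eta)$ with $C_\eta=\{x\in X:\eta(x)=0\}$. A normal selector is a map $E:\mathcal L(X)\to V$ with $C=\{x\in X: E(C)(x)=0\}$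 for every flat $C$. For $u\in U$ let $p_u$ be its image in $\operatorname{Sym}(U)$, for $Y\subseteq X$ let $p_Y=\prod_{x\in Y}p_x$, and for $\eta\in V$ let $D_\eta$ be its image in $\operatorname{Sym}(V)$. The algebra $\operatorname{Sym}(V)$ acts on $\operatorname{Sym}(U)$ by differential operators, $D_\eta$ acting as the derivation with $p_u\mapsto\eta(u)$. For $f\in\operatorname{Sym}(U)$ and $q\in\operatorname{Sym}(V)$ let $\langle f,q\rangle$ be the degree zero component of $q\cdot f$, and for an ideal $\mathcal I\subseteq\operatorname{Sym}(V)$ let $\ker\mathcal I=\{f\in\operatorname{Sym}(U):\langle f,q\rangle=0\text{ for all }q\in\mathcal I\}$. Define $$\mathcal I(X,k,J)=\operatorname{ideal}\{D_\eta^{\,m(\eta)+k+\chi(\eta)}:\eta\in V\setminus\{0\}\},$$ $$\mathcal I'(X,k,J,E)=\operatorname{ideal}\{D_{E(C)}^{\,m(C)+k+\chi(C)}:C\text{ a hyperplane or a maximal missing flat}\},$$ and $\mathcal P(X,k,J)=\operatorname{span}S(X,k,J)\subseteq\operatorname{Sym}(U)$, where $$S(X,k,J)=\{f\,p_Y: Y\subseteq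 X,\ f\in\operatorname{Sym}(U),\ 0\le\deg f\le\chi(X\setminus Y)+k-1\}\quad(k\ge1),$$ $$S(X,0,J)=\{p_Y: Y\subseteq X,\ \operatorname{clos}(X\setminus Y)\in J\},$$ $$S(X,-1,J)=\{p_Y: Y\subseteq X,\ |Y\setminus C|<m(C)-1+\chi(C)\text{ for all }C\in\mathcal L(X)\setminus\{X\}\}.$$ Then, for every normal selector $E$, $$\mathcal P(X,k,J)=\ker\mathcal I(X,k,J)\subseteq\ker\mathcal I'(X,k,J,E).$$ Furthermore, if $k\in\{-1,0\}$, then the ideal $\mathcal I'(X,k,J,E)$ does not depend on the choice of the normal selector $E$, and $$\mathcal P(X,k,J)=\ker\mathcal I(X,k,J)=\ker\mathcal I'(X,k,J,E).$$ -/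

import Mathlib

namespace Zonotopal

open Module

noncomputable section

/-! ### Differential operators on the symmetric algebra of the dual space -/

section Sym

variable {K : Type*} [Field K] {V : Type*} [AddCommGroup V] [Module K V]

/-- The algebra homomorphism `f ↦ f + D_v f ε` from `Sym(U)`, `U = V^*`, to the dual numbers over
`Sym(U)`; it sends `u ∈ U` to `u + u(v) ε`. -/
def taylor (v : V) : SymmetricAlgebra K (Dual K V) →ₐ[K]
    TrivSqZeroExt (SymmetricAlgebra K (Dual K V)) (SymmetricAlgebra K (Dual K V)) :=
  SymmetricAlgebra.lift
    ((TrivSqZeroExt.inlAlgHom K (SymmetricAlgebra K (Dual K V))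
        (SymmetricAlgebra K (Dual K V))).toLinearMap ∘ₗ SymmetricAlgebra.ι K (Dual K V)
      + ((TrivSqZeroExt.inrHom (SymmetricAlgebra K (Dual K V))
          (SymmetricAlgebra K (Dual K V))).restrictScalars K) ∘ₗ
        (Algebra.linearMap K (SymmetricAlgebra K (Dual K V))) ∘ₗ (Dual.eval K V v))

theorem taylor_fst (v : V) (f : SymmetricAlgebra K (Dual K V)) : (taylor v f).fst = f := by
  have h : (TrivSqZeroExt.fstHom K (SymmetricAlgebra K (Dual K V))
      (SymmetricAlgebra K (Dual K V))).comp (taylor v) = AlgHom.id K _ := by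
    apply SymmetricAlgebra.algHom_ext
    ext u
    simp [taylor]
  exact congrArg (fun F => F f) h

/-- The directional derivative `D_v` on `Sym(U)`, `U = V^*`: the unique derivation with
`D_v u = u(v)` for `u ∈ U` (see `dirDeriv_ι` and `dirDeriv_unique`). -/
def dirDeriv (v : V) :
    Derivation K (SymmetricAlgebra K (Dual K V)) (SymmetricAlgebra K (Dual K V)) :=
  Derivation.mk'
    (((TrivSqZeroExt.sndHom (SymmetricAlgebra K (Dual K V))
      (SymmetricAlgebra K (Dual K V))).restrictScalars K) ∘ₗ (taylor v).toLinearMap) (by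
      intro a b
      simp [taylor_fst, mul_comm])

@[simp] theorem dirDeriv_ι (v : V) (u : Dual K V) :
    dirDeriv v (SymmetricAlgebra.ι K (Dual K V) u) = algebraMap K _ (u v) := by
  simp [dirDeriv, taylor, Algebra.algebraMap_eq_smul_one]

/-- Two derivations on a symmetric algebra that agree on generators are equal. -/
theorem derivation_ext
    {D₁ D₂ : Derivation K (SymmetricAlgebra K (Dual K V)) (SymmetricAlgebra K (Dual K V))}
    (h : ∀ u, D₁ (SymmetricAlgebra.ι K (Dual K V) u) = D₂ (SymmetricAlgebra.ι K (Dual K V) u)) :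
    D₁ = D₂ := by
  ext f
  induction f using SymmetricAlgebra.induction with
  | algebraMap r => simp
  | ι u => exact h u
  | mul a b ha hb => simp [ha, hb]
  | add a b ha hb => simp [ha, hb]

theorem dirDeriv_unique (v : V)
    (D : Derivation K (SymmetricAlgebra K (Dual K V)) (SymmetricAlgebra K (Dual K V)))
    (h : ∀ u, D (SymmetricAlgebra.ι K (Dual K V) u) = algebraMap K _ (u v)) :
    D = dirDeriv v :=
  derivation_ext fun u => by rw [h, dirDeriv_ι]

theorem dirDeriv_comm (v w : V) (f : SymmetricAlgebra K (Dual K V)) :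
    dirDeriv v (dirDeriv w f) = dirDeriv w (dirDeriv v f) := by
  have h : ⁅dirDeriv (K := K) v, dirDeriv (K := K) w⁆ = 0 := derivation_ext fun u => by
    rw [Derivation.commutator_apply]; simp
  have h' := congrArg (fun D => D f) h
  simp only [Derivation.commutator_apply, Derivation.coe_zero, Pi.zero_apply] at h'
  exact sub_eq_zero.mp h'

variable (K V) in
/-- `v ↦ D_v` as a linear map to the endomorphisms of `Sym(U)`. -/
def dirDerivHom : V →ₗ[K] Module.End K (SymmetricAlgebra K (Dual K V)) where
  toFun v := (dirDeriv v).toLinearMap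
  map_add' v w := by
    have h : dirDeriv (K := K) (v + w) = dirDeriv v + dirDeriv w := derivation_ext fun u => by simp
    rw [h]; rfl
  map_smul' c v := by
    have h : dirDeriv (K := K) (c • v) = c • dirDeriv v := derivation_ext fun u => by
      simp [Algebra.smul_def]
    rw [h]; rfl

theorem symRingCon_le_ker : TensorAlgebra.symRingCon K V ≤
    RingCon.ker (TensorAlgebra.lift K (dirDerivHom K V)).toRingHom := by
  refine RingCon.ringConGen_le.2 ?_
  rintro _ _ ⟨v, w⟩
  rw [RingCon.ker_apply]
  ext f
  simpa [dirDerivHom] using dirDeriv_comm v w f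

variable (K V) in
/-- The action of `Sym(V)` on `Sym(U)`, `U = V^*`, by differential operators: the product
`v₁ ⋯ v_k` acts as `D_{v₁} ∘ ⋯ ∘ D_{v_k}` (see `diffOp_ι`). -/
def diffOp : SymmetricAlgebra K V →ₐ[K] Module.End K (SymmetricAlgebra K (Dual K V)) :=
  RingCon.liftₐ (TensorAlgebra.symRingCon K V) (TensorAlgebra.lift K (dirDerivHom K V))
    symRingCon_le_ker

@[simp] theorem diffOp_ι (v : V) (f : SymmetricAlgebra K (Dual K V)) :
    diffOp K V (SymmetricAlgebra.ι K V v) f = dirDeriv v f := by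
  have h : diffOp K V (SymmetricAlgebra.ι K V v) = dirDerivHom K V v :=
    (RingCon.liftₐ_mk _ _ symRingCon_le_ker (TensorAlgebra.ι K v)).trans
      (TensorAlgebra.lift_ι_apply _ v)
  rw [h]; rfl

/-- The pairing `⟨f, q⟩`, `f ∈ Sym(U)`, `q ∈ Sym(V)`: the degree zero component of `q · f`, where
`q` acts on `f` as a differential operator. -/
def pairing (f : SymmetricAlgebra K (Dual K V)) (q : SymmetricAlgebra K V) : K :=
  SymmetricAlgebra.algebraMapInv (diffOp K V q f)

/-- The kernel (inverse system) of an ideal of `Sym(V)`. -/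
def kernel (I : Ideal (SymmetricAlgebra K V)) : Submodule K (SymmetricAlgebra K (Dual K V)) where
  carrier := {f | ∀ q ∈ I, pairing f q = 0}
  add_mem' {f g} hf hg q hq := by
    have h₁ := hf q hq
    have h₂ := hg q hq
    simp only [pairing] at h₁ h₂ ⊢
    rw [map_add, map_add, h₁, h₂, add_zero]
  zero_mem' q _ := by simp [pairing]
  smul_mem' c f hf q hq := by
    have h := hf q hq
    simp only [pairing] at h ⊢
    rw [map_smul, map_smul, h, smul_zero]

variable (K V) in
/-- The elements of `Sym(U)` of degree at most `d`: the sum of the homogeneous components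
`Sym^i(U)`, `i ≤ d`, where `Sym^i(U)` is the `i`-th power of the submodule `U` of `Sym(U)`. -/
def degLE (d : ℕ) : Submodule K (SymmetricAlgebra K (Dual K V)) :=
  ⨆ i : ℕ, ⨆ _ : i ≤ d, LinearMap.range (SymmetricAlgebra.ι K (Dual K V)) ^ i

end Sym

/-! ### The matroid of a finite sequence of vectors

Subsequences of `X = (x_1, …, x_N)` are represented by their index sets. -/

section Matroid

variable {K : Type*} [Field K] {V : Type*} [AddCommGroup V] [Module K V] {N : ℕ}
  (X : Fin N → Dual K V)

/-- The rank of a subsequence: the maximal size of a linearly independent subfamily, that is, the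
dimension of the linear span. -/
def rank (A : Finset (Fin N)) : ℕ :=
  finrank K (Submodule.span K (X '' (A : Set (Fin N))))

/-- The closure of `A` in `X`: all elements whose addition to `A` does not increase the rank. -/
def clos (A : Finset (Fin N)) : Finset (Fin N) :=
  Finset.univ.filter fun i => rank X (insert i A) = rank X A

theorem mem_clos {A : Finset (Fin N)} {i : Fin N} :
    i ∈ clos X A ↔ X i ∈ Submodule.span K (X '' (A : Set (Fin N))) := by
  have hle : Submodule.span K (X '' (A : Set (Fin N))) ≤
      Submodule.span K (X '' ((insert i A : Finset (Fin N)) : Set (Fin N))) :=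
    Submodule.span_mono (Set.image_mono (by simp))
  have hfin : FiniteDimensional K
      (Submodule.span K (X '' ((insert i A : Finset (Fin N)) : Set (Fin N)))) :=
    FiniteDimensional.span_of_finite K (Set.toFinite _)
  rw [clos, Finset.mem_filter]
  simp only [rank, Finset.mem_univ, true_and]
  constructor
  · intro h
    rw [Submodule.eq_of_le_of_finrank_eq hle h.symm]
    exact Submodule.subset_span ⟨i, by simp, rfl⟩
  · intro h
    rw [Finset.coe_insert, Set.image_insert_eq, Submodule.span_insert_eq_span h]

theorem clos_clos (A : Finset (Fin N)) : clos X (clos X A) = clos X A := by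
  ext i
  rw [mem_clos, mem_clos]
  have h : Submodule.span K (X '' (clos X A : Set (Fin N))) =
      Submodule.span K (X '' (A : Set (Fin N))) := by
    apply le_antisymm
    · rw [Submodule.span_le]
      rintro _ ⟨j, hj, rfl⟩
      exact (mem_clos X).1 hj
    · refine Submodule.span_mono (Set.image_mono fun j hj => ?_)
      exact (mem_clos X).2 (Submodule.subset_span ⟨j, hj, rfl⟩)
  rw [h]

/-- The lattice of flats `L(X)`: subsequences equal to their closure, ordered by inclusion. -/
abbrev Flat : Type := {C : Finset (Fin N) // clos X C = C}

/-- The closure of a subsequence, as a flat. -/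
def closFlat (A : Finset (Fin N)) : Flat X := ⟨clos X A, clos_clos X A⟩

/-- A flat of rank `r - 1`, where `r = dim U`. -/
def IsHyperplane (C : Flat X) : Prop := rank X C.1 + 1 = finrank K (Dual K V)

open Classical in
/-- The flat `{x ∈ X : η(x) = 0}` defined by `η ∈ V`. -/
def zeroFlat (η : V) : Flat X :=
  ⟨Finset.univ.filter fun i => X i η = 0, by
    ext i
    rw [mem_clos]
    constructor
    · intro h
      have hle : Submodule.span K
          (X '' ((Finset.univ.filter fun i => X i η = 0 : Finset (Fin N)) : Set (Fin N))) ≤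
          LinearMap.ker (Dual.eval K V η) := by
        rw [Submodule.span_le]
        rintro _ ⟨j, hj, rfl⟩
        simpa using hj
      simpa using hle h
    · intro h
      exact Submodule.subset_span ⟨i, h, rfl⟩⟩

/-- `E` assigns to every flat `C` a defining normal, that is, a vector `E C` with
`C = {x ∈ X : E(C)(x) = 0}`. -/
def IsNormalSelector (E : Flat X → V) : Prop := ∀ C : Flat X, zeroFlat X (E C) = C

/-- `m(C) = |X ∖ C|`. -/
def m (C : Flat X) : ℕ := (Finset.univ \ C.1).card

variable {X}

open Classical in
/-- The indicator function `χ` of a set `J` of flats. -/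
def chi (J : Set (Flat X)) (C : Flat X) : ℕ := if C ∈ J then 1 else 0

/-- A maximal missing flat: a flat not in `J` that is maximal with this property. -/
def IsMaximalMissing (J : Set (Flat X)) (C : Flat X) : Prop := Maximal (fun D => D ∉ J) C

variable (X)

/-- The exponent `m(C) + k + χ(C)`. It is only used for `k ≥ -1` and flats `C ≠ X`; then
`m(C) ≥ 1`, so the integer is non-negative and `Int.toNat` does not change it. -/
def expo (k : ℤ) (J : Set (Flat X)) (C : Flat X) : ℕ := ((m X C : ℤ) + k + chi J C).toNat

/-- The ideal `I(X, k, J)` of `Sym(V)`. -/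
def powerIdeal (k : ℤ) (J : Set (Flat X)) : Ideal (SymmetricAlgebra K V) :=
  Ideal.span {q | ∃ η : V, η ≠ 0 ∧
    q = SymmetricAlgebra.ι K V η ^ expo X k J (zeroFlat X η)}

/-- The ideal `I'(X, k, J, E)` of `Sym(V)`. -/
def powerIdeal' (k : ℤ) (J : Set (Flat X)) (E : Flat X → V) : Ideal (SymmetricAlgebra K V) :=
  Ideal.span {q | ∃ C : Flat X, (IsHyperplane X C ∨ IsMaximalMissing J C) ∧
    q = SymmetricAlgebra.ι K V (E C) ^ expo X k J C}

/-- `p_Y = ∏_{x ∈ Y} p_x ∈ Sym(U)`. -/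
def pProd (Y : Finset (Fin N)) : SymmetricAlgebra K (Dual K V) :=
  ∏ i ∈ Y, SymmetricAlgebra.ι K (Dual K V) (X i)

/-- The set `S(X, k, J)`; the last case is the one of `k ≥ 1`. The condition
`0 ≤ deg f ≤ χ(X ∖ Y) + k - 1` says that `f` is non-zero of degree at most `χ(X ∖ Y) + k - 1`. -/
def genS (k : ℤ) (J : Set (Flat X)) : Set (SymmetricAlgebra K (Dual K V)) :=
  if k = -1 then
    {g | ∃ Y : Finset (Fin N), (∀ C : Flat X, C.1 ≠ Finset.univ →
      ((Y \ C.1).card : ℤ) < (m X C : ℤ) - 1 + chi J C) ∧ g = pProd X Y}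
  else if k = 0 then
    {g | ∃ Y : Finset (Fin N), closFlat X (Finset.univ \ Y) ∈ J ∧ g = pProd X Y}
  else
    {g | ∃ (Y : Finset (Fin N)) (f : SymmetricAlgebra K (Dual K V)), f ≠ 0 ∧
      (∃ d : ℕ, (d : ℤ) ≤ chi J (closFlat X (Finset.univ \ Y)) + k - 1 ∧ f ∈ degLE K V d) ∧
      g = f * pProd X Y}

/-- The space `P(X, k, J)`, the linear span of `S(X, k, J)`. -/
def pSpace (k : ℤ) (J : Set (Flat X)) : Submodule K (SymmetricAlgebra K (Dual K V)) :=
  Submodule.span K (genS X k J)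

end Matroid

end

end Zonotopal

namespace Zonotopal

open Module SymmetricAlgebra

/-! ### Directional derivatives, degree bounds and cancellation of linear factors. -/

section Calculus

variable {K : Type*} [Field K] {V : Type*} [AddCommGroup V] [Module K V]

/-! The pairing is non-degenerate in characteristic zero, so the kernel of an ideal consists of the
polynomials annihilated by its generators as differential operators (`mem_kernel_span`). Each claim
thus concerns the vanishing of powers of directional derivatives.

For k ≥ 0, the inclusion of P in the kernel is the Leibniz rule: a linear factor x of p_Y raises the
power of D_η needed to kill a product by one, and only if η(x) ≠ 0. The converse is
deletion-contraction on X. Restricting f to the hyperplane x = 0 and lifting back gives f = g + x h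
with g in P; it remains to see that h satisfies the conditions for X without x
(`deletion_pow_eq_zero`). Usually one cancels the factor x. If deleting x moves the flat of η out of
J, the condition at η alone is too weak, and one differentiates the conditions at η + tζ in t. The
upper set is encoded by subspaces of U, so that it survives deletion unchanged and contraction by
taking preimages.

For k = 0 the same induction runs with a single normal for each hyperplane and each maximal missing
flat (`MemNormalKernel.mem_powerSpan`). Deletion may destroy spanning, so conditions at all vectors
orthogonal to X are carried along.

The case k = -1 reduces to k = 0 with upper set {X}: in the chain P(X,0,{X}) ⊆ P(X,-1,J) ⊆ ker
I(X,-1,J) ⊆ ker I(X,0,{X}) the outer terms agree, so all four do.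

For k = -1 and k = 0, ker I' = ker I for every normal selector. Since hyperplane normals span V, I'
contains a power of the irrelevant ideal; such ideals are determined by their kernels
(`le_of_kernel_le`), so I' does not depend on the selector. -/

theorem dirDerivHom_ι (v : V) (u : Dual K V) :
    dirDerivHom K V v (ι K (Dual K V) u) = algebraMap K _ (u v) :=
  dirDeriv_ι v u

theorem dirDerivHom_mul (v : V) (f g : SymmetricAlgebra K (Dual K V)) :
    dirDerivHom K V v (f * g) = f * dirDerivHom K V v g + dirDerivHom K V v f * g := by
  change dirDeriv v (f * g) = f * dirDeriv v g + dirDeriv v f * g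
  rw [Derivation.leibniz, smul_eq_mul, smul_eq_mul, mul_comm g]

theorem dirDerivHom_algebraMap (v : V) (a : K) :
    dirDerivHom K V v (algebraMap K _ a) = 0 :=
  (dirDeriv v).map_algebraMap a

theorem commute_dirDerivHom (v w : V) : Commute (dirDerivHom K V v) (dirDerivHom K V w) :=
  LinearMap.ext fun f => dirDeriv_comm v w f

theorem dirDerivHom_ι_mul (v : V) (u : Dual K V) (f : SymmetricAlgebra K (Dual K V)) :
    dirDerivHom K V v (ι K (Dual K V) u * f) =
      ι K (Dual K V) u * dirDerivHom K V v f + u v • f := by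
  rw [dirDerivHom_mul, dirDerivHom_ι, Algebra.smul_def]

/-- Leibniz rule for iterated directional derivatives of `u f` with `u` linear. -/
theorem dirDerivHom_pow_ι_mul (v : V) (u : Dual K V) (f : SymmetricAlgebra K (Dual K V)) (n : ℕ) :
    (dirDerivHom K V v ^ (n + 1)) (ι K (Dual K V) u * f) =
      ι K (Dual K V) u * (dirDerivHom K V v ^ (n + 1)) f
        + ((n + 1 : K) * u v) • (dirDerivHom K V v ^ n) f := by
  induction n with
  | zero => simp [dirDerivHom_ι_mul]
  | succ n ih =>
    rw [pow_succ', Module.End.mul_apply, ih, map_add, map_smul, dirDerivHom_ι_mul,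
      ← Module.End.mul_apply, ← pow_succ', ← Module.End.mul_apply, ← pow_succ', add_assoc,
      ← add_smul]
    congr 2
    push_cast
    ring

theorem dirDerivHom_pow_ι_mul_of_eq_zero {v : V} {u : Dual K V} (huv : u v = 0)
    (f : SymmetricAlgebra K (Dual K V)) (n : ℕ) :
    (dirDerivHom K V v ^ n) (ι K (Dual K V) u * f) =
      ι K (Dual K V) u * (dirDerivHom K V v ^ n) f := by
  cases n with
  | zero => simp
  | succ n => rw [dirDerivHom_pow_ι_mul, huv]; simp

theorem pow_apply_eq_zero_of_le {M : Type*} [AddCommGroup M] [Module K M] {A : Module.End K M}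
    {m n : ℕ} (h : m ≤ n) {f : M} (hf : (A ^ m) f = 0) : (A ^ n) f = 0 := by
  obtain ⟨j, rfl⟩ := Nat.exists_eq_add_of_le' h
  rw [pow_add, Module.End.mul_apply, hf, map_zero]

variable {M : Type*} [AddCommGroup M] [Module K M]

variable (K M) in
/-- The elements of `Sym(M)` of degree less than `n`. -/
def symLT (n : ℕ) : Submodule K (SymmetricAlgebra K M) :=
  ⨆ i : ℕ, ⨆ _ : i < n, LinearMap.range (ι K M) ^ i

theorem symLT_zero : symLT K M 0 = ⊥ := by simp [symLT]

theorem pow_range_le_symLT {i n : ℕ} (h : i < n) :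
    LinearMap.range (ι K M) ^ i ≤ symLT K M n :=
  le_iSup₂_of_le i h le_rfl

theorem symLT_mono {m n : ℕ} (h : m ≤ n) : symLT K M m ≤ symLT K M n :=
  iSup₂_le fun _ hi => pow_range_le_symLT (hi.trans_le h)

theorem symLT_succ (n : ℕ) :
    symLT K M (n + 1) = symLT K M n ⊔ LinearMap.range (ι K M) ^ n := by
  refine le_antisymm (iSup₂_le fun i hi => ?_)
    (sup_le (symLT_mono n.le_succ) (pow_range_le_symLT n.lt_succ_self))
  rcases (Nat.lt_succ_iff.1 hi).lt_or_eq with h | rfl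
  · exact (pow_range_le_symLT h).trans le_sup_left
  · exact le_sup_right

theorem range_mul_symLT_le (n : ℕ) :
    LinearMap.range (ι K M) * symLT K M n ≤ symLT K M (n + 1) := by
  rw [symLT, Submodule.mul_iSup]
  refine iSup_le fun i => ?_
  rw [Submodule.mul_iSup]
  refine iSup_le fun hi => ?_
  rw [← pow_succ']
  exact pow_range_le_symLT (Nat.succ_lt_succ hi)

theorem exists_mem_symLT (f : SymmetricAlgebra K M) : ∃ n, f ∈ symLT K M n := by
  have key : ∀ i (g : SymmetricAlgebra K M), g ∈ LinearMap.range (ι K M) ^ i →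
      g ∈ ⨆ i, LinearMap.range (ι K M) ^ i := fun i g hg =>
    Submodule.mem_iSup_of_mem i hg
  have h : f ∈ ⨆ i, LinearMap.range (ι K M) ^ i := by
    induction f using SymmetricAlgebra.induction with
    | algebraMap r =>
      refine key 0 _ ?_
      rw [pow_zero]
      exact Submodule.algebraMap_mem r
    | ι u =>
      refine key 1 _ ?_
      rw [pow_one]
      exact ⟨u, rfl⟩
    | mul a b ha hb =>
      have h : (⨆ i, LinearMap.range (ι K M) ^ i) *
          (⨆ i, LinearMap.range (ι K M) ^ i) ≤
          ⨆ i, LinearMap.range (ι K M) ^ i := by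
        rw [Submodule.iSup_mul]
        refine iSup_le fun i => ?_
        rw [Submodule.mul_iSup]
        refine iSup_le fun j => ?_
        rw [← pow_add]
        exact le_iSup (fun i => LinearMap.range (ι K M) ^ i) (i + j)
      exact h (Submodule.mul_mem_mul ha hb)
    | add a b ha hb => exact add_mem ha hb
  refine Submodule.iSup_induction _ (motive := fun f => ∃ n, f ∈ symLT K M n) h
    (fun i x hx => ⟨i + 1, pow_range_le_symLT i.lt_succ_self hx⟩) ⟨0, zero_mem _⟩ ?_
  rintro x y ⟨a, ha⟩ ⟨b, hb⟩
  exact ⟨max a b, add_mem (symLT_mono (le_max_left _ _) ha) (symLT_mono (le_max_right _ _) hb)⟩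

theorem degLE_eq (n : ℕ) : degLE K V n = symLT K (Dual K V) (n + 1) := by
  simp only [degLE, symLT, Nat.lt_succ_iff]

theorem dirDerivHom_mem_pow_range (v : V) (n : ℕ) {f : SymmetricAlgebra K (Dual K V)}
    (hf : f ∈ LinearMap.range (ι K (Dual K V)) ^ (n + 1)) :
    dirDerivHom K V v f ∈ LinearMap.range (ι K (Dual K V)) ^ n := by
  induction n generalizing f with
  | zero =>
    rw [zero_add, pow_one] at hf
    obtain ⟨u, rfl⟩ := hf
    rw [dirDerivHom_ι, pow_zero]
    exact Submodule.algebraMap_mem _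
  | succ n ih =>
    rw [pow_succ'] at hf
    refine Submodule.mul_induction_on hf ?_ fun x y hx hy => by
      rw [map_add]; exact add_mem hx hy
    rintro _ ⟨u, rfl⟩ g hg
    rw [dirDerivHom_ι_mul]
    refine add_mem ?_ (Submodule.smul_mem _ _ hg)
    rw [pow_succ']
    exact Submodule.mul_mem_mul ⟨u, rfl⟩ (ih hg)

theorem dirDerivHom_mem_symLT (v : V) {n : ℕ} {f : SymmetricAlgebra K (Dual K V)}
    (hf : f ∈ symLT K (Dual K V) (n + 1)) : dirDerivHom K V v f ∈ symLT K (Dual K V) n := by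
  suffices h : symLT K (Dual K V) (n + 1) ≤ (symLT K (Dual K V) n).comap (dirDerivHom K V v) from
    h hf
  refine iSup₂_le fun i hi g hg => ?_
  cases i with
  | zero =>
    rw [pow_zero, Submodule.mem_one] at hg
    obtain ⟨a, rfl⟩ := hg
    rw [Submodule.mem_comap, dirDerivHom_algebraMap]
    exact zero_mem _
  | succ i =>
    exact pow_range_le_symLT (Nat.lt_of_succ_lt_succ hi) (dirDerivHom_mem_pow_range v i hg)

theorem dirDerivHom_pow_eq_zero_of_mem_symLT (v : V) {n : ℕ} {f : SymmetricAlgebra K (Dual K V)}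
    (hf : f ∈ symLT K (Dual K V) n) : (dirDerivHom K V v ^ n) f = 0 := by
  induction n generalizing f with
  | zero => simpa [symLT_zero] using hf
  | succ n ih =>
    rw [pow_succ, Module.End.mul_apply]
    exact ih (dirDerivHom_mem_symLT v hf)

theorem exists_dirDerivHom_pow_eq_zero (v : V) (f : SymmetricAlgebra K (Dual K V)) :
    ∃ n, (dirDerivHom K V v ^ n) f = 0 :=
  (exists_mem_symLT f).imp fun _ hn => dirDerivHom_pow_eq_zero_of_mem_symLT v hn

/-- The Euler identity: `∑ j, u_j D_{v_j}`, for dual bases `u`, `v`, is multiplication by `i` on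
homogeneous elements of degree `i`. -/
theorem euler_apply [FiniteDimensional K V] {i : ℕ} {f : SymmetricAlgebra K (Dual K V)}
    (hf : f ∈ LinearMap.range (ι K (Dual K V)) ^ i) :
    ∑ j, ι K (Dual K V) ((finBasis K V).coord j) * dirDerivHom K V (finBasis K V j) f
      = (i : K) • f := by
  induction i generalizing f with
  | zero =>
    rw [pow_zero, Submodule.mem_one] at hf
    obtain ⟨a, rfl⟩ := hf
    simp [dirDerivHom_algebraMap]
  | succ i ih =>
    rw [pow_succ'] at hf
    refine Submodule.mul_induction_on hf ?_ fun x y hx hy => by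
      simp only [map_add, mul_add, Finset.sum_add_distrib, hx, hy, smul_add]
    rintro _ ⟨u, rfl⟩ g hg
    have hu : ι K (Dual K V) u =
        ∑ j, (u (finBasis K V j)) • ι K (Dual K V) ((finBasis K V).coord j) := by
      simp only [← map_smul, ← map_sum]
      rw [(finBasis K V).sum_dual_apply_smul_coord]
    have h1 : ∀ j, ι K (Dual K V) ((finBasis K V).coord j) *
        dirDerivHom K V (finBasis K V j) (ι K (Dual K V) u * g) =
        ι K (Dual K V) u * (ι K (Dual K V) ((finBasis K V).coord j) *
          dirDerivHom K V (finBasis K V j) g) +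
        ((u (finBasis K V j)) • ι K (Dual K V) ((finBasis K V).coord j)) * g := fun j => by
      rw [dirDerivHom_ι_mul, mul_add, mul_left_comm, mul_smul_comm, smul_mul_assoc]
    rw [Finset.sum_congr rfl fun j _ => h1 j, Finset.sum_add_distrib, ← Finset.mul_sum, ih hg,
      ← Finset.sum_mul, ← hu, mul_smul_comm]
    push_cast
    rw [add_smul, one_smul]

theorem euler_mem_symLT [FiniteDimensional K V] {n : ℕ} {f : SymmetricAlgebra K (Dual K V)}
    (hf : ∀ v, dirDerivHom K V v f ∈ symLT K (Dual K V) n) :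
    ∑ j, ι K (Dual K V) ((finBasis K V).coord j) * dirDerivHom K V (finBasis K V j) f
      ∈ symLT K (Dual K V) (n + 1) :=
  sum_mem fun _ _ => range_mul_symLT_le n (Submodule.mul_mem_mul ⟨_, rfl⟩ (hf _))

theorem ι_dual_ne_zero {u : Dual K V} (hu : u ≠ 0) : ι K (Dual K V) u ≠ 0 := by
  intro h
  apply hu
  ext v
  have h1 := dirDerivHom_ι (K := K) v u
  rw [h, map_zero] at h1
  exact ((algebraMap_eq_zero_iff _ _).1 h1.symm)

theorem dirDerivHom_pow_eq_zero_of_ι_mul_of_eq_zero {v : V} {u : Dual K V}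
    (hu : u ≠ 0) (huv : u v = 0) {n : ℕ} {f : SymmetricAlgebra K (Dual K V)}
    (h : (dirDerivHom K V v ^ n) (ι K (Dual K V) u * f) = 0) :
    (dirDerivHom K V v ^ n) f = 0 := by
  rw [dirDerivHom_pow_ι_mul_of_eq_zero huv] at h
  exact (mul_eq_zero.1 h).resolve_left (ι_dual_ne_zero hu)

variable [CharZero K]

/-- The Euler operator multiplies the component of degree d by d, which is invertible for d > 0. A
bound on all derivatives bounds the Euler image, so top components of too high degree can be peeled
off one at a time. -/
theorem mem_symLT_of_dirDerivHom_mem [FiniteDimensional K V] {n : ℕ}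
    {f : SymmetricAlgebra K (Dual K V)}
    (hf : ∀ v, dirDerivHom K V v f ∈ symLT K (Dual K V) n) : f ∈ symLT K (Dual K V) (n + 1) := by
  obtain ⟨d, hd⟩ := exists_mem_symLT f
  induction d with
  | zero => exact symLT_mono (Nat.zero_le _) hd
  | succ d ih =>
    rcases Nat.lt_or_ge d (n + 1) with h | h
    · exact symLT_mono h hd
    refine ih ?_
    have hE := symLT_mono h (euler_mem_symLT hf)
    rw [symLT_succ] at hd
    obtain ⟨a, ha, b, hb, rfl⟩ := Submodule.mem_sup.1 hd
    have ha' : ∑ j, ι K (Dual K V) ((finBasis K V).coord j) *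
        dirDerivHom K V (finBasis K V j) a ∈ symLT K (Dual K V) d := by
      refine symLT_mono ?_ (euler_mem_symLT (n := d - 1) fun v => dirDerivHom_mem_symLT v ?_)
      · omega
      · rwa [Nat.sub_add_cancel (by omega)]
    simp only [map_add, mul_add, Finset.sum_add_distrib] at hE
    have hb' := (Submodule.add_mem_iff_right _ ha').1 hE
    rw [euler_apply hb] at hb'
    have hd0 : (d : K) ≠ 0 := Nat.cast_ne_zero.2 (by omega)
    exact add_mem ha ((Submodule.smul_mem_iff _ hd0).1 hb')

/-- If `(A + t B)^(n+1)` kills `f` for infinitely many `t`, then so does the coefficient of `t`. -/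
theorem pow_apply_eq_zero_of_infinite {M : Type*} [AddCommGroup M] [Module K M]
    {A B : Module.End K M} (hAB : Commute A B) {n : ℕ} {f : M} {T : Set K} (hT : T.Infinite)
    (h : ∀ t ∈ T, ((A + t • B) ^ (n + 1)) f = 0) : (A ^ n) (B f) = 0 := by
  rw [← Module.forall_dual_apply_eq_zero_iff K]
  intro φ
  -- After applying a functional, the binomial expansion is a polynomial in t with infinitely many
  -- roots. Its coefficient of t is n + 1 times the wanted value.
  let P : Polynomial K := ∑ m ∈ Finset.range (n + 2),
    Polynomial.monomial m (φ ((A ^ (n + 1 - m)) ((B ^ m) f)) * ((n + 1).choose m : K))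
  have hP : ∀ t ∈ T, P.eval t = 0 := by
    intro t ht
    have h1 := congrArg φ (h t ht)
    rw [add_comm, (hAB.symm.smul_left t).add_pow, map_zero] at h1
    rw [← h1, LinearMap.sum_apply, map_sum, Polynomial.eval_finsetSum]
    refine Finset.sum_congr rfl fun m _ => ?_
    rw [Polynomial.eval_monomial, smul_pow, Module.End.mul_apply,
      smul_mul_assoc, LinearMap.smul_apply, (hAB.symm.pow_pow _ _).eq, Module.End.mul_apply,
      Module.End.natCast_apply]
    simp only [map_nsmul, map_smul, smul_eq_mul, nsmul_eq_mul]
    ring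
  have hP0 : P = 0 := Polynomial.eq_zero_of_infinite_isRoot P (hT.mono hP)
  have hc := congrArg (fun P => P.coeff 1) hP0
  simp only [P, Polynomial.finsetSum_coeff, Polynomial.coeff_monomial, Polynomial.coeff_zero,
    Finset.sum_ite_eq', Finset.mem_range] at hc
  rw [if_pos (by omega)] at hc
  have hn : ((n + 1).choose 1 : K) ≠ 0 := by
    rw [Nat.choose_one_right]; exact Nat.cast_ne_zero.2 n.succ_ne_zero
  simpa using (mul_eq_zero.1 hc).resolve_right hn

/-- An element killed by all `n`-th powers of directional derivatives has degree less than `n`. -/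
theorem mem_symLT_of_dirDerivHom_pow_eq_zero [FiniteDimensional K V] {n : ℕ}
    {f : SymmetricAlgebra K (Dual K V)} (hf : ∀ v, (dirDerivHom K V v ^ n) f = 0) :
    f ∈ symLT K (Dual K V) n := by
  induction n generalizing f with
  | zero => simpa [symLT_zero] using hf 0
  | succ n ih =>
    -- Polarization: the powers of D_{v+tw} kill f for every t, hence D_v^n kills D_w f for all v
    -- and w.
    refine mem_symLT_of_dirDerivHom_mem fun w => ih fun v => ?_
    refine pow_apply_eq_zero_of_infinite (commute_dirDerivHom v w) Set.infinite_univ fun t _ => ?_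
    rw [← map_smul, ← map_add]
    exact hf _

/-- D_v is nilpotent on g. If D_v^(d+1) g = 0, applying D_v^d to the relation leaves (d + n + 1)
u(v) D_v^d g = 0 with a non-zero scalar, so the exponent descends to zero. -/
theorem eq_zero_of_ι_mul_dirDerivHom_add_smul {v : V} {u : Dual K V} (huv : u v ≠ 0) {n : ℕ}
    {g : SymmetricAlgebra K (Dual K V)}
    (h : ι K (Dual K V) u * dirDerivHom K V v g + ((n + 1 : K) * u v) • g = 0) : g = 0 := by
  have step : ∀ d, (dirDerivHom K V v ^ (d + 1)) g = 0 → (dirDerivHom K V v ^ d) g = 0 := by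
    intro d hd
    have h1 := congrArg (dirDerivHom K V v ^ d) h
    have hne : (d : K) + (n + 1) ≠ 0 := by exact_mod_cast (by omega : d + (n + 1) ≠ 0)
    cases d with
    | zero =>
      rw [zero_add, pow_one] at hd
      rw [hd, mul_zero, zero_add] at h
      refine (smul_eq_zero.1 h).resolve_left (mul_ne_zero ?_ huv)
      simpa using hne
    | succ d =>
      rw [map_add, dirDerivHom_pow_ι_mul, map_smul, map_zero, ← Module.End.mul_apply,
        ← pow_succ, hd, mul_zero, zero_add, ← Module.End.mul_apply, ← pow_succ, ← add_smul,
        ← add_mul] at h1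
      refine (smul_eq_zero.1 h1).resolve_left (mul_ne_zero ?_ huv)
      simpa using hne
  obtain ⟨d, hd⟩ := exists_dirDerivHom_pow_eq_zero v g
  induction d with
  | zero => simpa using hd
  | succ d ih => exact ih (step d hd)

theorem dirDerivHom_pow_eq_zero_of_ι_mul {v : V} {u : Dual K V} (huv : u v ≠ 0) {n : ℕ}
    {f : SymmetricAlgebra K (Dual K V)}
    (h : (dirDerivHom K V v ^ (n + 1)) (ι K (Dual K V) u * f) = 0) :
    (dirDerivHom K V v ^ n) f = 0 := by
  rw [dirDerivHom_pow_ι_mul, pow_succ', Module.End.mul_apply] at h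
  exact eq_zero_of_ι_mul_dirDerivHom_add_smul huv h

end Calculus

/-! ### Restriction of polynomials to the hyperplane u = 0. -/

section Restriction

variable {K : Type*} [Field K] {V : Type*} [AddCommGroup V] [Module K V]

/-- Restriction of linear forms to the kernel of `u`. -/
def restr (u : Dual K V) : Dual K V →ₗ[K] Dual K (LinearMap.ker u) :=
  (LinearMap.ker u).subtype.dualMap

@[simp] theorem restr_apply (u w : Dual K V) (v : LinearMap.ker u) : restr u w v = w v := rfl

theorem restr_surjective (u : Dual K V) : Function.Surjective (restr u) :=
  LinearMap.dualMap_surjective_of_injective (LinearMap.ker u).injective_subtype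

theorem ker_restr (u : Dual K V) : LinearMap.ker (restr u) = Submodule.span K {u} := by
  refine le_antisymm (fun w hw => ?_) ?_
  · have h := mem_span_of_iInf_ker_le_ker (ι := Unit) (L := fun _ => u) (K := w) (by
      rw [iInf_const]
      intro v hv
      exact LinearMap.congr_fun (LinearMap.mem_ker.1 hw) ⟨v, hv⟩)
    simpa using h
  · rw [Submodule.span_singleton_le_iff_mem, LinearMap.mem_ker]
    ext v
    exact v.2

theorem finrank_comap_restr [FiniteDimensional K V] {u : Dual K V} (hu : u ≠ 0)
    (W : Submodule K (Dual K (LinearMap.ker u))) :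
    finrank K (W.comap (restr u)) = finrank K W + 1 := by
  have h := LinearMap.finrank_range_add_finrank_ker (K := K) (V := W.comap (restr u))
    (V₂ := Dual K (LinearMap.ker u)) ((restr u).domRestrict (W.comap (restr u)))
  have hle : LinearMap.ker (restr u) ≤ W.comap (restr u) := fun w hw => by
    rw [Submodule.mem_comap, LinearMap.mem_ker.1 hw]; exact zero_mem _
  rw [LinearMap.range_domRestrict, Submodule.map_comap_eq_of_surjective (restr_surjective u),
    LinearMap.ker_domRestrict, ← Submodule.submoduleOf, (Submodule.submoduleOfEquivOfLe hle).finrank_eq,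
    ker_restr, finrank_span_singleton hu] at h
  exact h.symm

/-- Restriction of polynomials to the kernel of `u`. -/
def symRestr (u : Dual K V) :
    SymmetricAlgebra K (Dual K V) →ₐ[K] SymmetricAlgebra K (Dual K (LinearMap.ker u)) :=
  SymmetricAlgebra.lift (ι K (Dual K (LinearMap.ker u)) ∘ₗ restr u)

@[simp] theorem symRestr_ι (u w : Dual K V) :
    symRestr u (ι K (Dual K V) w) = ι K (Dual K (LinearMap.ker u)) (restr u w) :=
  SymmetricAlgebra.lift_ι_apply _ w

theorem symRestr_dirDerivHom (u : Dual K V) (v : LinearMap.ker u)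
    (f : SymmetricAlgebra K (Dual K V)) :
    symRestr u (dirDerivHom K V v f) = dirDerivHom K (LinearMap.ker u) v (symRestr u f) := by
  induction f using SymmetricAlgebra.induction with
  | algebraMap r => rw [dirDerivHom_algebraMap, AlgHom.commutes, dirDerivHom_algebraMap, map_zero]
  | ι w => rw [dirDerivHom_ι, symRestr_ι, dirDerivHom_ι, AlgHom.commutes, restr_apply]
  | mul a b ha hb => 
    rw [dirDerivHom_mul, map_add, map_mul, map_mul, ha, hb, map_mul (symRestr u) a b,
      dirDerivHom_mul]
  | add a b ha hb => simp only [map_add, ha, hb]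

theorem symRestr_dirDerivHom_pow (u : Dual K V) (v : LinearMap.ker u) (n : ℕ)
    (f : SymmetricAlgebra K (Dual K V)) :
    symRestr u ((dirDerivHom K V v ^ n) f) =
      (dirDerivHom K (LinearMap.ker u) v ^ n) (symRestr u f) := by
  induction n with
  | zero => simp
  | succ n ih =>
    rw [pow_succ', Module.End.mul_apply, symRestr_dirDerivHom, ih, pow_succ', Module.End.mul_apply]

/-- Lifting of polynomials along a section of the restriction map. -/
theorem exists_symRestr_section (u : Dual K V) :
    ∃ s : SymmetricAlgebra K (Dual K (LinearMap.ker u)) →ₐ[K] SymmetricAlgebra K (Dual K V),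
      (∀ f, symRestr u (s f) = f) ∧
      (∀ f, ι K (Dual K V) u ∣ f - s (symRestr u f)) ∧
      ∀ n, ∀ f ∈ symLT K (Dual K (LinearMap.ker u)) n, s f ∈ symLT K (Dual K V) n := by
  obtain ⟨l, hl⟩ := (restr u).exists_rightInverse_of_surjective
    (LinearMap.range_eq_top.2 (restr_surjective u))
  have hl' : ∀ w, restr u (l w) = w := fun w => LinearMap.congr_fun hl w
  let s : SymmetricAlgebra K (Dual K (LinearMap.ker u)) →ₐ[K] SymmetricAlgebra K (Dual K V) :=
    SymmetricAlgebra.lift (ι K (Dual K V) ∘ₗ l)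
  have hs : ∀ w, s (ι K _ w) = ι K (Dual K V) (l w) := fun w => SymmetricAlgebra.lift_ι_apply _ w
  refine ⟨s, fun f => ?_, fun f => ?_, fun n f hf => ?_⟩
  · induction f using SymmetricAlgebra.induction with
    | algebraMap r => simp only [AlgHom.commutes]
    | ι w => rw [hs, symRestr_ι, hl']
    | mul a b ha hb => simp only [map_mul, ha, hb]
    | add a b ha hb => simp only [map_add, ha, hb]
  · induction f using SymmetricAlgebra.induction with
    | algebraMap r => simp only [AlgHom.commutes, sub_self, dvd_zero]
    | ι w =>
      rw [symRestr_ι, hs, ← map_sub]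
      have h : w - l (restr u w) ∈ LinearMap.ker (restr u) := by
        rw [LinearMap.mem_ker, map_sub, hl', sub_self]
      rw [ker_restr, Submodule.mem_span_singleton] at h
      obtain ⟨a, ha⟩ := h
      rw [← ha, map_smul, Algebra.smul_def]
      exact dvd_mul_left _ _
    | mul a b ha hb =>
      have h : a * b - s (symRestr u (a * b)) =
          a * (b - s (symRestr u b)) + (a - s (symRestr u a)) * s (symRestr u b) := by
        rw [map_mul, map_mul]; ring
      rw [h]
      exact dvd_add (hb.mul_left _) (ha.mul_right _)
    | add a b ha hb =>
      rw [map_add, map_add, add_sub_add_comm]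
      exact dvd_add ha hb
  · suffices h : symLT K (Dual K (LinearMap.ker u)) n ≤ (symLT K (Dual K V) n).comap s.toLinearMap
      from h hf
    refine iSup₂_le fun i hi => ?_
    rw [← Submodule.map_le_iff_le_comap, Submodule.map_pow]
    refine le_trans (pow_le_pow_left' ?_ i) (pow_range_le_symLT hi)
    rintro _ ⟨_, ⟨w, rfl⟩, rfl⟩
    exact ⟨l w, (hs w).symm⟩

end Restriction

/-! ### The space P for k ≥ 0 as the kernel of the power ideal. -/

section PowerSpan

variable {K : Type*} [Field K] {V : Type*} [AddCommGroup V] [Module K V] {σ : Type*}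

/-- The span of the vectors `X i`, `i ∈ A`. -/
def spanOn (X : σ → Dual K V) (A : Finset σ) : Submodule K (Dual K V) :=
  Submodule.span K (X '' (A : Set σ))

theorem spanOn_mono (X : σ → Dual K V) {A B : Finset σ} (h : A ⊆ B) : spanOn X A ≤ spanOn X B :=
  Submodule.span_mono (Set.image_mono (Finset.coe_subset.2 h))

theorem mem_spanOn (X : σ → Dual K V) {A : Finset σ} {i : σ} (hi : i ∈ A) : X i ∈ spanOn X A :=
  Submodule.subset_span ⟨i, hi, rfl⟩

theorem spanOn_le {X : σ → Dual K V} {A : Finset σ} {W : Submodule K (Dual K V)} :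
    spanOn X A ≤ W ↔ ∀ i ∈ A, X i ∈ W := by
  rw [spanOn, Submodule.span_le, Set.image_subset_iff]
  rfl

theorem spanOn_empty (X : σ → Dual K V) : spanOn X ∅ = ⊥ := by simp [spanOn]

theorem apply_eq_zero_of_mem_spanOn {X : σ → Dual K V} {A : Finset σ} {η : V}
    (h : ∀ i ∈ A, X i η = 0) {u : Dual K V} (hu : u ∈ spanOn X A) : u η = 0 := by
  have hle : spanOn X A ≤ LinearMap.ker (Dual.eval K V η) := spanOn_le.2 h
  exact hle hu

open Classical in
/-- The set of indices `i ∈ S` with `X i ∈ W`. -/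
noncomputable def flatOn (X : σ → Dual K V) (S : Finset σ) (W : Submodule K (Dual K V)) :
    Finset σ :=
  S.filter fun i => X i ∈ W

open Classical in
/-- The set of indices `i ∈ S` with `X i η = 0`. -/
noncomputable def zeroSet (X : σ → Dual K V) (S : Finset σ) (η : V) : Finset σ :=
  S.filter fun i => X i η = 0

open Classical in
/-- The number of indices `i ∈ S` with `X i η ≠ 0`. -/
noncomputable def numNonzero (X : σ → Dual K V) (S : Finset σ) (η : V) : ℕ :=
  (S.filter fun i => X i η ≠ 0).card

open Classical in
/-- The indicator function of a set of subspaces. -/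
noncomputable def ind {M : Type*} [AddCommGroup M] [Module K M] (c : Set (Submodule K M))
    (W : Submodule K M) : ℕ := if W ∈ c then 1 else 0

theorem ind_of_mem {M : Type*} [AddCommGroup M] [Module K M] {c : Set (Submodule K M)}
    {W : Submodule K M} (h : W ∈ c) : ind c W = 1 := if_pos h

theorem ind_of_notMem {M : Type*} [AddCommGroup M] [Module K M] {c : Set (Submodule K M)}
    {W : Submodule K M} (h : W ∉ c) : ind c W = 0 := if_neg h

theorem ind_le_one {M : Type*} [AddCommGroup M] [Module K M] (c : Set (Submodule K M))
    (W : Submodule K M) : ind c W ≤ 1 := by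
  rw [ind]; split_ifs <;> omega

theorem ind_mono {M : Type*} [AddCommGroup M] [Module K M] {c : Set (Submodule K M)}
    (hc : IsUpperSet c) {W W' : Submodule K M} (h : W ≤ W') : ind c W ≤ ind c W' := by
  by_cases hW : W ∈ c
  · rw [ind_of_mem hW, ind_of_mem (hc h hW)]
  · rw [ind_of_notMem hW]; exact Nat.zero_le _

/-- `∏ i ∈ Y, X i` in `Sym(U)`. -/
def prodOn (X : σ → Dual K V) (Y : Finset σ) : SymmetricAlgebra K (Dual K V) :=
  ∏ i ∈ Y, ι K (Dual K V) (X i)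

theorem numNonzero_mono (X : σ → Dual K V) {Y S : Finset σ} (h : Y ⊆ S) (η : V) :
    numNonzero X Y η ≤ numNonzero X S η := by
  classical
  exact Finset.card_le_card (Finset.filter_subset_filter _ h)

variable [DecidableEq σ]

theorem spanOn_insert (X : σ → Dual K V) (i : σ) (A : Finset σ) :
    spanOn X (insert i A) = Submodule.span K {X i} ⊔ spanOn X A := by
  rw [spanOn, Finset.coe_insert, Set.image_insert_eq, Submodule.span_insert]
  rfl

theorem spanOn_insert_of_mem {X : σ → Dual K V} {i : σ} {A : Finset σ} (h : X i ∈ spanOn X A) :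
    spanOn X (insert i A) = spanOn X A := by
  rw [spanOn_insert, sup_eq_right, Submodule.span_singleton_le_iff_mem]
  exact h

theorem spanOn_erase_of_eq_zero {X : σ → Dual K V} {i : σ} (h : X i = 0) (A : Finset σ) :
    spanOn X (A.erase i) = spanOn X A := by
  refine le_antisymm (spanOn_mono X (A.erase_subset i)) (spanOn_le.2 fun j hj => ?_)
  by_cases hji : j = i
  · rw [hji, h]; exact zero_mem _
  · exact mem_spanOn X (Finset.mem_erase.2 ⟨hji, hj⟩)

theorem zeroSet_insert_of_ne {X : σ → Dual K V} {x : σ} {S : Finset σ} {η : V} (h : X x η ≠ 0) :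
    zeroSet X (insert x S) η = zeroSet X S η := by
  rw [zeroSet, Finset.filter_insert, if_neg h]; rfl

theorem zeroSet_insert_of_eq {X : σ → Dual K V} {x : σ} {S : Finset σ} {η : V} (h : X x η = 0) :
    zeroSet X (insert x S) η = insert x (zeroSet X S η) := by
  rw [zeroSet, Finset.filter_insert, if_pos h]; rfl

theorem numNonzero_insert_of_ne {X : σ → Dual K V} {x : σ} {S : Finset σ} (hx : x ∉ S) {η : V}
    (h : X x η ≠ 0) : numNonzero X (insert x S) η = numNonzero X S η + 1 := by
  rw [numNonzero, Finset.filter_insert, if_pos h, Finset.card_insert_of_notMem (by simp [hx])]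
  rfl

theorem numNonzero_insert_of_eq {X : σ → Dual K V} {x : σ} {S : Finset σ} {η : V}
    (h : X x η = 0) : numNonzero X (insert x S) η = numNonzero X S η := by
  rw [numNonzero, Finset.filter_insert, if_neg (not_not.2 h)]; rfl

/-- The span of all products `f ∏ i ∈ Y, X i` with `deg f < k + χ(S ∖ Y)`. -/
def powerSpan (X : σ → Dual K V) (c : Set (Submodule K (Dual K V))) (k : ℕ) (S : Finset σ) :
    Submodule K (SymmetricAlgebra K (Dual K V)) :=
  Submodule.span K
    {g | ∃ Y ⊆ S, ∃ f ∈ symLT K (Dual K V) (k + ind c (spanOn X (S \ Y))), g = f * prodOn X Y}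

theorem mul_prodOn_mem_powerSpan {X : σ → Dual K V} {c : Set (Submodule K (Dual K V))} {k : ℕ}
    {S Y : Finset σ} (hY : Y ⊆ S) {f : SymmetricAlgebra K (Dual K V)}
    (hf : f ∈ symLT K (Dual K V) (k + ind c (spanOn X (S \ Y)))) :
    f * prodOn X Y ∈ powerSpan X c k S :=
  Submodule.subset_span ⟨Y, hY, f, hf, rfl⟩

theorem dirDerivHom_pow_mul_prodOn (X : σ → Dual K V) (η : V) {a : ℕ} (Y : Finset σ)
    {f : SymmetricAlgebra K (Dual K V)} (hf : (dirDerivHom K V η ^ a) f = 0) :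
    (dirDerivHom K V η ^ (a + numNonzero X Y η)) (f * prodOn X Y) = 0 := by
  induction Y using Finset.induction_on with
  | empty => simpa [prodOn, numNonzero] using hf
  | insert i Y hi ih =>
    have h1 : f * prodOn X (insert i Y) = ι K (Dual K V) (X i) * (f * prodOn X Y) := by
      rw [prodOn, Finset.prod_insert hi, mul_left_comm]; rfl
    rw [h1]
    by_cases h : X i η = 0
    · rw [numNonzero_insert_of_eq h, dirDerivHom_pow_ι_mul_of_eq_zero h, ih, mul_zero]
    · rw [numNonzero_insert_of_ne hi h, ← add_assoc, dirDerivHom_pow_ι_mul, ih, smul_zero,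
        pow_succ', Module.End.mul_apply, ih, map_zero, mul_zero, add_zero]

/-- The dichotomy behind P ⊆ ker I. In the first case monotonicity of χ gives χ(S ∖ Y) ≤ χ(η); in
the second the spare factor absorbs χ(S ∖ Y) ≤ 1. -/
theorem sdiff_subset_zeroSet_or (X : σ → Dual K V) {Y S : Finset σ} (h : Y ⊆ S) (η : V) :
    S \ Y ⊆ zeroSet X S η ∨ numNonzero X Y η + 1 ≤ numNonzero X S η := by
  classical
  refine or_iff_not_imp_left.2 fun hn => Finset.card_lt_card ?_
  rw [Finset.not_subset] at hn
  obtain ⟨i, hi, hi'⟩ := hn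
  rw [Finset.mem_sdiff] at hi
  refine Finset.ssubset_iff_subset_ne.2 ⟨Finset.filter_subset_filter _ h, fun he => hi.2 ?_⟩
  have h1 : i ∈ S.filter fun i => X i η ≠ 0 :=
    Finset.mem_filter.2 ⟨hi.1, fun h0 => hi' (Finset.mem_filter.2 ⟨hi.1, h0⟩)⟩
  rw [← he] at h1
  exact (Finset.mem_filter.1 h1).1

theorem dirDerivHom_pow_eq_zero_of_mem_powerSpan {X : σ → Dual K V}
    {c : Set (Submodule K (Dual K V))} (hc : IsUpperSet c) {k : ℕ} {S : Finset σ}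
    {f : SymmetricAlgebra K (Dual K V)} (hf : f ∈ powerSpan X c k S) (η : V) :
    (dirDerivHom K V η ^ (numNonzero X S η + k + ind c (spanOn X (zeroSet X S η)))) f = 0 := by
  suffices h : powerSpan X c k S ≤ LinearMap.ker
      (dirDerivHom K V η ^ (numNonzero X S η + k + ind c (spanOn X (zeroSet X S η)))) from h hf
  refine Submodule.span_le.2 ?_
  rintro _ ⟨Y, hY, f, hf, rfl⟩
  refine pow_apply_eq_zero_of_le ?_ (dirDerivHom_pow_mul_prodOn X η Y
    (dirDerivHom_pow_eq_zero_of_mem_symLT η hf))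
  have h1 := numNonzero_mono X hY η
  rcases sdiff_subset_zeroSet_or X hY η with h | h
  · have := ind_mono hc (spanOn_mono X h)
    omega
  · have := ind_le_one c (spanOn X (S \ Y))
    omega

theorem ι_mul_mem_powerSpan {X : σ → Dual K V} {c : Set (Submodule K (Dual K V))} {k : ℕ}
    {S : Finset σ} {x : σ} (hx : x ∉ S) {f : SymmetricAlgebra K (Dual K V)}
    (hf : f ∈ powerSpan X c k S) :
    ι K (Dual K V) (X x) * f ∈ powerSpan X c k (insert x S) := by
  suffices h : powerSpan X c k S ≤ (powerSpan X c k (insert x S)).comap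
      (LinearMap.mulLeft K (ι K (Dual K V) (X x))) from h hf
  refine Submodule.span_le.2 ?_
  rintro _ ⟨Y, hY, f, hf, rfl⟩
  have h1 : ι K (Dual K V) (X x) * (f * prodOn X Y) = f * prodOn X (insert x Y) := by
    rw [prodOn, prodOn, Finset.prod_insert fun h => hx (hY h), mul_left_comm]
  change ι K (Dual K V) (X x) * (f * prodOn X Y) ∈ powerSpan X c k (insert x S)
  rw [h1]
  refine mul_prodOn_mem_powerSpan (Finset.insert_subset_insert x hY) ?_
  rwa [Finset.insert_sdiff_insert, Finset.sdiff_insert_of_notMem hx]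

theorem powerSpan_le_insert_of_eq_zero {X : σ → Dual K V} {c : Set (Submodule K (Dual K V))}
    {k : ℕ} {S : Finset σ} {x : σ} (hx : x ∉ S) (h0 : X x = 0) :
    powerSpan X c k S ≤ powerSpan X c k (insert x S) := by
  refine Submodule.span_le.2 ?_
  rintro _ ⟨Y, hY, f, hf, rfl⟩
  refine mul_prodOn_mem_powerSpan (hY.trans (Finset.subset_insert x S)) ?_
  rwa [Finset.insert_sdiff_of_notMem _ fun h => hx (hY h), spanOn_insert_of_mem]
  rw [h0]
  exact zero_mem _

/-! ### Contraction -/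

theorem comap_restr_spanOn (X : σ → Dual K V) (x : σ) (A : Finset σ) :
    (spanOn (fun i => restr (X x) (X i)) A).comap (restr (X x)) = spanOn X (insert x A) := by
  have h : spanOn (fun i => restr (X x) (X i)) A = (spanOn X A).map (restr (X x)) := by
    rw [spanOn, spanOn, Submodule.map_span, Set.image_image]
  rw [h, Submodule.comap_map_eq, ker_restr, spanOn_insert, sup_comm]

/-- The set of subspaces of the dual of `ker u` whose preimage lies in `c`. -/
def contract (u : Dual K V) (c : Set (Submodule K (Dual K V))) :
    Set (Submodule K (Dual K (LinearMap.ker u))) :=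
  {W | W.comap (restr u) ∈ c}

theorem isUpperSet_contract (u : Dual K V) {c : Set (Submodule K (Dual K V))}
    (hc : IsUpperSet c) : IsUpperSet (contract u c) :=
  fun _ _ h hW => hc (Submodule.comap_mono h) hW

theorem mem_contract_spanOn (X : σ → Dual K V) (c : Set (Submodule K (Dual K V))) (x : σ)
    (A : Finset σ) : spanOn (fun i => restr (X x) (X i)) A ∈ contract (X x) c ↔
      spanOn X (insert x A) ∈ c := by
  rw [← comap_restr_spanOn]
  rfl

theorem ind_contract_spanOn (X : σ → Dual K V) (c : Set (Submodule K (Dual K V))) (x : σ)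
    (A : Finset σ) : ind (contract (X x) c) (spanOn (fun i => restr (X x) (X i)) A) =
      ind c (spanOn X (insert x A)) := by
  by_cases h : spanOn X (insert x A) ∈ c
  · rw [ind_of_mem h, ind_of_mem ((mem_contract_spanOn X c x A).2 h)]
  · rw [ind_of_notMem h, ind_of_notMem ((mem_contract_spanOn X c x A).not.2 h)]

/-- Lifting from the contraction: if the restriction of `f` to `ker (X x)` lies in the space of the
contraction, then `f` lies in the space of `insert x S` up to a multiple of `X x`. -/
theorem exists_eq_add_ι_mul {X : σ → Dual K V} {c : Set (Submodule K (Dual K V))} {k : ℕ}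
    {S : Finset σ} {x : σ} (hx : x ∉ S) {f : SymmetricAlgebra K (Dual K V)}
    (hf : symRestr (X x) f ∈ powerSpan (fun i => restr (X x) (X i)) (contract (X x) c) k S) :
    ∃ g ∈ powerSpan X c k (insert x S), ∃ h, f = g + ι K (Dual K V) (X x) * h := by
  obtain ⟨s, hs, hdvd, hdeg⟩ := exists_symRestr_section (X x)
  have hle : powerSpan (fun i => restr (X x) (X i)) (contract (X x) c) k S ≤
      (powerSpan X c k (insert x S)).map (symRestr (X x)).toLinearMap := by
    refine Submodule.span_le.2 ?_
    rintro _ ⟨Y, hY, f, hf, rfl⟩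
    -- Keeping x outside Y makes the complement of Y in `insert x S` span the preimage of the
    -- contracted span, so the degree bounds agree.
    refine ⟨s f * prodOn X Y, mul_prodOn_mem_powerSpan (hY.trans (Finset.subset_insert x S)) ?_, ?_⟩
    · rw [Finset.insert_sdiff_of_notMem _ fun h => hx (hY h), ← ind_contract_spanOn]
      exact hdeg _ _ hf
    · simp only [AlgHom.toLinearMap_apply, map_mul, hs, prodOn, map_prod, symRestr_ι]
  obtain ⟨g, hg, hgf⟩ := hle hf
  have h0 : symRestr (X x) (f - g) = 0 := by
    rw [map_sub, ← hgf, AlgHom.toLinearMap_apply, sub_self]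
  obtain ⟨h, hh⟩ := hdvd (f - g)
  rw [h0, map_zero, sub_zero] at hh
  exact ⟨g, hg, h, by rw [← hh]; abel⟩

theorem dirDerivHom_pow_eq_zero_of_ι_mul_insert [CharZero K] {X : σ → Dual K V} {S : Finset σ}
    {x : σ} (hx : x ∉ S) (hX : X x ≠ 0) {η : V} {j : ℕ} {f : SymmetricAlgebra K (Dual K V)}
    (h : (dirDerivHom K V η ^ (numNonzero X (insert x S) η + j)) (ι K (Dual K V) (X x) * f) = 0) :
    (dirDerivHom K V η ^ (numNonzero X S η + j)) f = 0 := by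
  by_cases h0 : X x η = 0
  · rw [numNonzero_insert_of_eq h0] at h
    exact dirDerivHom_pow_eq_zero_of_ι_mul_of_eq_zero hX h0 h
  · rw [numNonzero_insert_of_ne hx h0, add_right_comm] at h
    exact dirDerivHom_pow_eq_zero_of_ι_mul h0 h

theorem numNonzero_restr (X : σ → Dual K V) (x : σ) (S : Finset σ) (η : LinearMap.ker (X x)) :
    numNonzero (fun i => restr (X x) (X i)) S η = numNonzero X (insert x S) (η : V) := by
  rw [numNonzero_insert_of_eq η.2]
  rfl

theorem zeroSet_restr (X : σ → Dual K V) (x : σ) (S : Finset σ) (η : LinearMap.ker (X x)) :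
    insert x (zeroSet (fun i => restr (X x) (X i)) S η) = zeroSet X (insert x S) (η : V) := by
  rw [zeroSet_insert_of_eq η.2]
  rfl

theorem exists_apply_ne_zero_of_notMem [FiniteDimensional K V] {W : Submodule K (Dual K V)}
    {u : Dual K V} (hu : u ∉ W) : ∃ ζ : V, u ζ ≠ 0 ∧ ∀ w ∈ W, w ζ = 0 := by
  by_contra! h
  apply hu
  rw [← Subspace.dualCoannihilator_dualAnnihilator_eq (W := W), Submodule.mem_dualAnnihilator]
  intro v hv
  by_contra h0
  obtain ⟨w, hw, hwv⟩ := h v h0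
  exact hwv ((Submodule.mem_dualCoannihilator v).1 hv w hw)

theorem mem_powerSpan_empty [FiniteDimensional K V] [CharZero K] {X : σ → Dual K V}
    {c : Set (Submodule K (Dual K V))} {k : ℕ} {f : SymmetricAlgebra K (Dual K V)}
    (hf : ∀ η, (dirDerivHom K V η ^ (k + ind c ⊥)) f = 0) : f ∈ powerSpan X c k ∅ := by
  have h := mul_prodOn_mem_powerSpan (X := X) (c := c) (k := k) (f := f) (Finset.Subset.refl ∅) (by
    rw [Finset.sdiff_self, spanOn_empty]
    exact mem_symLT_of_dirDerivHom_pow_eq_zero hf)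
  simpa [prodOn] using h

/-- If χ does not change, the factor X x cancels. Otherwise η kills x and adding x to the zero set
of η moves its span into c, so the hypothesis at η is one order too weak. Nearby vectors η + tζ with
the same zero set on S, but not killing x, supply the missing order. -/
theorem deletion_pow_eq_zero [FiniteDimensional K V] [CharZero K] {X : σ → Dual K V}
    {c : Set (Submodule K (Dual K V))} (hc : IsUpperSet c) {k : ℕ} {S : Finset σ} {x : σ}
    (hx : x ∉ S) (hX : X x ≠ 0)
    {f : SymmetricAlgebra K (Dual K V)}
    (hf : ∀ η, (dirDerivHom K V η ^ (numNonzero X (insert x S) η + k +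
      ind c (spanOn X (zeroSet X (insert x S) η)))) (ι K (Dual K V) (X x) * f) = 0) (η : V) :
    (dirDerivHom K V η ^ (numNonzero X S η + k + ind c (spanOn X (zeroSet X S η)))) f = 0 := by
  classical
  by_cases hne : ind c (spanOn X (zeroSet X (insert x S) η)) = ind c (spanOn X (zeroSet X S η))
  · have h := hf η
    rw [hne, add_assoc] at h
    rw [add_assoc]
    exact dirDerivHom_pow_eq_zero_of_ι_mul_insert hx hX h
  have hη : X x η = 0 := by
    by_contra h
    exact hne (by rw [zeroSet_insert_of_ne h])
  rw [zeroSet_insert_of_eq hη] at hne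
  have hxW : X x ∉ spanOn X (zeroSet X S η) := fun h => hne (by rw [spanOn_insert_of_mem h])
  have hle : spanOn X (zeroSet X S η) ≤ spanOn X (insert x (zeroSet X S η)) :=
    spanOn_mono X (Finset.subset_insert _ _)
  have hW : spanOn X (zeroSet X S η) ∉ c := fun h =>
    hne (by rw [ind_of_mem h, ind_of_mem (hc hle h)])
  obtain ⟨ζ, hζ, hζW⟩ := exists_apply_ne_zero_of_notMem hxW
  rw [ind_of_notMem hW, add_zero]
  -- The excluded t are 0, where x is killed, and the values at which some X i not vanishing at η
  -- could vanish at η + tζ.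
  have hT : ((insert 0 (S.image fun i => -X i η / X i ζ) : Finset K) : Set K)ᶜ.Infinite :=
    (Finset.finite_toSet _).infinite_compl
  have h1 := pow_apply_eq_zero_of_infinite (commute_dirDerivHom η ζ) (n := numNonzero X S η + k)
    (f := ι K (Dual K V) (X x) * f) hT fun t ht => by
      simp only [Set.mem_compl_iff, Finset.mem_coe, Finset.mem_insert, Finset.mem_image, not_or,
        not_exists, not_and] at ht
      have hz : ∀ i ∈ S, X i (η + t • ζ) = 0 ↔ X i η = 0 := by
        intro i hi
        rw [map_add, map_smul, smul_eq_mul]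
        constructor
        · intro h
          by_contra h0
          have hi0 : X i ζ ≠ 0 := fun h' => h0 (by rwa [h', mul_zero, add_zero] at h)
          refine ht.2 i hi ?_
          rw [div_eq_iff hi0]
          linear_combination -h
        · intro h
          rw [h, hζW _ (mem_spanOn X (Finset.mem_filter.2 ⟨hi, h⟩)), mul_zero, add_zero]
      have hxt : X x (η + t • ζ) ≠ 0 := by
        rw [map_add, map_smul, hη, zero_add, smul_eq_mul]
        exact mul_ne_zero ht.1 hζ
      have hZ : zeroSet X S (η + t • ζ) = zeroSet X S η := Finset.filter_congr hz
      have hN : numNonzero X S (η + t • ζ) = numNonzero X S η :=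
        congrArg Finset.card (Finset.filter_congr fun i hi => (hz i hi).not)
      have h := hf (η + t • ζ)
      rwa [numNonzero_insert_of_ne hx hxt, zeroSet_insert_of_ne hxt, hZ, hN, ind_of_notMem hW,
        add_zero, add_right_comm, map_add, map_smul] at h
  -- As η kills x, D_η^(N+k), with N = `numNonzero X S η`, commutes with multiplication by X x. So g
  -- = D_η^(N+k) f satisfies (X x) D_ζ g + (X x)(ζ) g = 0, which forces g = 0.
  rw [dirDerivHom_ι_mul, map_add, dirDerivHom_pow_ι_mul_of_eq_zero hη, map_smul,
    ← Module.End.mul_apply, ((commute_dirDerivHom η ζ).pow_left _).eq, Module.End.mul_apply] at h1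
  refine eq_zero_of_ι_mul_dirDerivHom_add_smul hζ (n := 0) ?_
  simpa using h1

/-- The space spanned by the products `f ∏ i ∈ Y, X i` is the kernel of the power ideal. -/
theorem mem_powerSpan_of_dirDerivHom_pow_eq_zero {K : Type*} [Field K] [CharZero K] {σ : Type*}
    [DecidableEq σ] (k : ℕ) (S : Finset σ) {V : Type*} [AddCommGroup V] [Module K V]
    [FiniteDimensional K V] {X : σ → Dual K V} {c : Set (Submodule K (Dual K V))}
    (hc : IsUpperSet c) {f : SymmetricAlgebra K (Dual K V)}
    (hf : ∀ η, (dirDerivHom K V η ^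
      (numNonzero X S η + k + ind c (spanOn X (zeroSet X S η)))) f = 0) :
    f ∈ powerSpan X c k S := by
  induction S using Finset.induction_on generalizing V with
  | empty =>
    refine mem_powerSpan_empty fun η => ?_
    simpa [numNonzero, zeroSet, spanOn_empty] using hf η
  | insert x S hx ih =>
    by_cases h0 : X x = 0
    · refine powerSpan_le_insert_of_eq_zero hx h0 (ih hc fun η => ?_)
      have hη : X x η = 0 := by rw [h0]; rfl
      have h := hf η
      rwa [numNonzero_insert_of_eq hη, zeroSet_insert_of_eq hη,
        spanOn_insert_of_mem (by rw [h0]; exact zero_mem _)] at h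
    -- Contraction supplies g. Since g already satisfies all kernel conditions, so does (X x) h, and
    -- deletion applies to h.
    · obtain ⟨g, hg, h, rfl⟩ := exists_eq_add_ι_mul (c := c) (k := k) (f := f) hx
        (ih (isUpperSet_contract _ hc) fun η => by
          rw [numNonzero_restr, ind_contract_spanOn, zeroSet_restr, ← symRestr_dirDerivHom_pow,
            hf, map_zero])
      refine add_mem hg (ι_mul_mem_powerSpan hx (ih hc (deletion_pow_eq_zero hc hx h0 fun η => ?_)))
      have h1 := hf η
      rwa [map_add, dirDerivHom_pow_eq_zero_of_mem_powerSpan hc hg, zero_add] at h1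

end PowerSpan

/-! ### One normal per hyperplane and per maximal missing flat, for k = 0. -/

section NormalKernel

variable {K : Type*} [Field K] {V : Type*} [AddCommGroup V] [Module K V] {σ : Type*}

/-- On `S`, the vector `η` vanishes exactly at the vectors that lie in `W`. -/
def IsNormalOn (X : σ → Dual K V) (S : Finset σ) (W : Submodule K (Dual K V)) (η : V) : Prop :=
  ∀ i ∈ S, X i η = 0 ↔ X i ∈ W

theorem IsNormalOn.spanOn_zeroSet {X : σ → Dual K V} {S A : Finset σ} (hA : A ⊆ S) {η : V}
    (h : IsNormalOn X S (spanOn X A) η) : spanOn X (zeroSet X S η) = spanOn X A := by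
  classical
  refine le_antisymm (spanOn_le.2 fun i hi => ?_) (spanOn_le.2 fun i hi => mem_spanOn X ?_)
  · obtain ⟨hi, hi0⟩ := Finset.mem_filter.1 hi
    exact (h i hi).1 hi0
  · exact Finset.mem_filter.2 ⟨hA hi, (h i (hA hi)).2 (mem_spanOn X hi)⟩

theorem zeroSet_eq_self {X : σ → Dual K V} {S : Finset σ} {η : V} (h : ∀ i ∈ S, X i η = 0) :
    zeroSet X S η = S := by
  classical
  exact Finset.filter_true_of_mem h

theorem numNonzero_eq_zero {X : σ → Dual K V} {S : Finset σ} {η : V} (h : ∀ i ∈ S, X i η = 0) :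
    numNonzero X S η = 0 := by
  classical
  rw [numNonzero, Finset.card_eq_zero, Finset.filter_eq_empty_iff]
  exact fun i hi => not_not.2 (h i hi)

/-- The kernel conditions given by one normal vector for each hyperplane and each maximal missing
flat, and by all vectors orthogonal to `X`. -/
structure MemNormalKernel (X : σ → Dual K V) (c : Set (Submodule K (Dual K V))) (S : Finset σ)
    (f : SymmetricAlgebra K (Dual K V)) : Prop where
  -- These conditions matter once S no longer spans. If the span of S is not in c, the exponent is 0
  -- and f = 0; this covers the top flat excluded in `missing`.
  perp : ∀ η, (∀ i ∈ S, X i η = 0) → (dirDerivHom K V η ^ ind c (spanOn X S)) f = 0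
  hyperplane : ∀ A ⊆ S, finrank K (spanOn X A) + 1 = finrank K (spanOn X S) →
    ∃ η, IsNormalOn X S (spanOn X A) η ∧
      (dirDerivHom K V η ^ (numNonzero X S η + ind c (spanOn X A))) f = 0
  missing : ∀ A ⊆ S, spanOn X A ∉ c → spanOn X A ≠ spanOn X S →
    (∀ B ⊆ S, spanOn X A < spanOn X B → spanOn X B ∈ c) →
    ∃ η, IsNormalOn X S (spanOn X A) η ∧ (dirDerivHom K V η ^ numNonzero X S η) f = 0

variable [DecidableEq σ]

theorem MemNormalKernel.of_add {X : σ → Dual K V} {c : Set (Submodule K (Dual K V))}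
    (hc : IsUpperSet c) {S : Finset σ} {g h : SymmetricAlgebra K (Dual K V)}
    (hgh : MemNormalKernel X c S (g + h)) (hg : g ∈ powerSpan X c 0 S) :
    MemNormalKernel X c S h where
  perp η hη := by
    have h1 := hgh.perp η hη
    have h2 := dirDerivHom_pow_eq_zero_of_mem_powerSpan hc hg η
    rw [numNonzero_eq_zero hη, zeroSet_eq_self hη, zero_add, zero_add] at h2
    rwa [map_add, h2, zero_add] at h1
  hyperplane A hA hr := by
    obtain ⟨η, hη, h1⟩ := hgh.hyperplane A hA hr
    have h2 := dirDerivHom_pow_eq_zero_of_mem_powerSpan hc hg η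
    rw [hη.spanOn_zeroSet hA, add_zero] at h2
    rw [map_add, h2, zero_add] at h1
    exact ⟨η, hη, h1⟩
  missing A hA hm hne hmax := by
    obtain ⟨η, hη, h1⟩ := hgh.missing A hA hm hne hmax
    have h2 := dirDerivHom_pow_eq_zero_of_mem_powerSpan hc hg η
    rw [hη.spanOn_zeroSet hA, ind_of_notMem hm, add_zero, add_zero] at h2
    rw [map_add, h2, zero_add] at h1
    exact ⟨η, hη, h1⟩

theorem IsNormalOn.of_insert {X : σ → Dual K V} {S : Finset σ} {x : σ}
    {W : Submodule K (Dual K V)} {η : V} (h : IsNormalOn X (insert x S) W η) : IsNormalOn X S W η :=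
  fun i hi => h i (Finset.mem_insert_of_mem hi)

theorem MemNormalKernel.of_insert_of_eq_zero {X : σ → Dual K V} {c : Set (Submodule K (Dual K V))}
    {S : Finset σ} {x : σ} (h0 : X x = 0) {f : SymmetricAlgebra K (Dual K V)}
    (hf : MemNormalKernel X c (insert x S) f) : MemNormalKernel X c S f := by
  have hη : ∀ η, X x η = 0 := fun η => by rw [h0]; rfl
  have hS : spanOn X (insert x S) = spanOn X S :=
    spanOn_insert_of_mem (by rw [h0]; exact zero_mem _)
  refine ⟨fun η h => ?_, fun A hA hr => ?_, fun A hA hm hne hmax => ?_⟩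
  · rw [← hS]
    exact hf.perp η (Finset.forall_mem_insert _ _ _ |>.2 ⟨hη η, h⟩)
  · obtain ⟨η, h1, h2⟩ := hf.hyperplane A (hA.trans (Finset.subset_insert x S)) (by rw [hr, hS])
    rw [numNonzero_insert_of_eq (hη η)] at h2
    exact ⟨η, h1.of_insert, h2⟩
  · obtain ⟨η, h1, h2⟩ := hf.missing A (hA.trans (Finset.subset_insert x S)) hm (by rwa [hS])
      fun B hB hlt => by
        rw [← spanOn_erase_of_eq_zero h0 B] at hlt ⊢
        exact hmax _ (Finset.subset_insert_iff.1 hB) hlt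
    rw [numNonzero_insert_of_eq (hη η)] at h2
    exact ⟨η, h1.of_insert, h2⟩

theorem IsNormalOn.restr {X : σ → Dual K V} {S A : Finset σ} {x : σ} {η : V}
    (h : IsNormalOn X (insert x S) (spanOn X (insert x A)) η) :
    ∃ hη : η ∈ LinearMap.ker (X x), IsNormalOn (fun i => restr (X x) (X i)) S
      (spanOn (fun i => Zonotopal.restr (X x) (X i)) A) ⟨η, hη⟩ := by
  refine ⟨(h x (Finset.mem_insert_self _ _)).2 (mem_spanOn X (Finset.mem_insert_self _ _)),
    fun i hi => ?_⟩
  rw [← Submodule.mem_comap, comap_restr_spanOn]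
  exact h i (Finset.mem_insert_of_mem hi)

/-- Taking preimages under restriction matches spans in the contraction with spans containing X x,
preserves order and raises rank by one. Hyperplanes and maximal missing flats thus correspond to
ones containing x, whose normals lie in the kernel of X x. -/
theorem MemNormalKernel.restr [FiniteDimensional K V] {X : σ → Dual K V}
    {c : Set (Submodule K (Dual K V))} {S : Finset σ} {x : σ} (hX : X x ≠ 0)
    {f : SymmetricAlgebra K (Dual K V)} (hf : MemNormalKernel X c (insert x S) f) :
    MemNormalKernel (fun i => restr (X x) (X i)) (contract (X x) c) S (symRestr (X x) f) := by
  have hinj : ∀ A B : Finset σ, spanOn (fun i => Zonotopal.restr (X x) (X i)) A =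
      spanOn (fun i => Zonotopal.restr (X x) (X i)) B ↔
      spanOn X (insert x A) = spanOn X (insert x B) := fun A B => by
    rw [← comap_restr_spanOn, ← comap_restr_spanOn,
      (Submodule.comap_injective_of_surjective (restr_surjective (X x))).eq_iff]
  refine ⟨fun η h => ?_, fun A hA hr => ?_, fun A hA hm hne hmax => ?_⟩
  · rw [ind_contract_spanOn, ← symRestr_dirDerivHom_pow, hf.perp, map_zero]
    exact Finset.forall_mem_insert _ _ _ |>.2 ⟨η.2, h⟩
  · obtain ⟨η, h1, h2⟩ := hf.hyperplane (insert x A) (Finset.insert_subset_insert x hA) (by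
      rw [← comap_restr_spanOn, ← comap_restr_spanOn, finrank_comap_restr hX,
        finrank_comap_restr hX, hr])
    obtain ⟨hη, h3⟩ := h1.restr
    refine ⟨_, h3, ?_⟩
    rw [ind_contract_spanOn, ← symRestr_dirDerivHom_pow, numNonzero_restr, h2, map_zero]
  · rw [mem_contract_spanOn] at hm
    rw [Ne, hinj] at hne
    obtain ⟨η, h1, h2⟩ := hf.missing (insert x A) (Finset.insert_subset_insert x hA) hm hne
      fun B hB hlt => by
        have hxB : X x ∈ spanOn X B := hlt.le (mem_spanOn X (Finset.mem_insert_self _ _))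
        -- The index x need not belong to B, although X x lies in the span of B.
        have hB' : spanOn X (insert x (B.erase x)) = spanOn X B := by
          by_cases hx : x ∈ B
          · rw [Finset.insert_erase hx]
          · rw [Finset.erase_eq_of_notMem hx, spanOn_insert_of_mem hxB]
        rw [← hB', ← mem_contract_spanOn]
        refine hmax _ (Finset.subset_insert_iff.1 hB) (lt_of_le_of_ne ?_ ?_)
        · rw [← Submodule.comap_le_comap_iff_of_surjective (restr_surjective (X x)),
            comap_restr_spanOn, comap_restr_spanOn, hB']
          exact hlt.le
        · rw [Ne, hinj, hB']
          exact hlt.ne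
    obtain ⟨hη, h3⟩ := h1.restr
    refine ⟨_, h3, ?_⟩
    rw [← symRestr_dirDerivHom_pow, numNonzero_restr, h2, map_zero]

theorem finrank_spanOn_insert {X : σ → Dual K V} {A : Finset σ} {x : σ}
    (hx : X x ∉ spanOn X A) : finrank K (spanOn X (insert x A)) = finrank K (spanOn X A) + 1 := by
  have hfin : FiniteDimensional K (spanOn X A) :=
    FiniteDimensional.span_of_finite K (Set.toFinite _)
  have h0 : X x ≠ 0 := fun h => hx (by rw [h]; exact zero_mem _)
  have h := Submodule.finrank_sup_add_finrank_inf_eq (Submodule.span K {X x}) (spanOn X A)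
  rw [← spanOn_insert, finrank_span_singleton h0, disjoint_iff.1
    ((Submodule.disjoint_span_singleton' h0).2 hx).symm, finrank_bot] at h
  omega

/-- If X x is not in the span of S, then S itself is a hyperplane of the larger family. Every η
orthogonal to S is a multiple of its chosen normal ζ plus a vector that also kills x. -/
theorem MemNormalKernel.perp_deletion [CharZero K] {X : σ → Dual K V}
    {c : Set (Submodule K (Dual K V))} {S : Finset σ} {x : σ} (hx : x ∉ S) (hX : X x ≠ 0)
    (hcS : spanOn X (insert x S) ∈ c) {f : SymmetricAlgebra K (Dual K V)}
    (hf : MemNormalKernel X c (insert x S) (ι K (Dual K V) (X x) * f)) (η : V)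
    (hη : ∀ i ∈ S, X i η = 0) : (dirDerivHom K V η ^ ind c (spanOn X S)) f = 0 := by
  have key : ∀ η, (∀ i ∈ S, X i η = 0) → X x η = 0 → dirDerivHom K V η f = 0 := by
    intro η hη h0
    have h := hf.perp η (Finset.forall_mem_insert _ _ _ |>.2 ⟨h0, hη⟩)
    rw [ind_of_mem hcS] at h
    simpa using dirDerivHom_pow_eq_zero_of_ι_mul_of_eq_zero hX h0 h
  by_cases hxS : X x ∈ spanOn X S
  · rw [spanOn_insert_of_mem hxS] at hcS
    rw [ind_of_mem hcS, pow_one]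
    exact key η hη (apply_eq_zero_of_mem_spanOn hη hxS)
  · obtain ⟨ζ, hζ, h1⟩ := hf.hyperplane S (Finset.subset_insert x S)
      (finrank_spanOn_insert hxS).symm
    have hζS : ∀ i ∈ S, X i ζ = 0 := fun i hi =>
      (hζ i (Finset.mem_insert_of_mem hi)).2 (mem_spanOn X hi)
    have hζx : X x ζ ≠ 0 := (hζ x (Finset.mem_insert_self _ _)).not.2 hxS
    have h2 := dirDerivHom_pow_eq_zero_of_ι_mul_insert hx hX h1
    rw [numNonzero_eq_zero hζS, zero_add] at h2
    by_cases hc : spanOn X S ∈ c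
    · rw [ind_of_mem hc, pow_one] at h2 ⊢
      have h3 := key (η - (X x η / X x ζ) • ζ) (fun i hi => by
        rw [map_sub, map_smul, hη i hi, hζS i hi, smul_zero, sub_zero]) (by
        rw [map_sub, map_smul, smul_eq_mul, div_mul_cancel₀ _ hζx, sub_self])
      rwa [map_sub, map_smul, LinearMap.sub_apply, LinearMap.smul_apply, h2, smul_zero,
        sub_zero] at h3
    · rwa [ind_of_notMem hc] at h2 ⊢

theorem MemNormalKernel.hyperplane_deletion [CharZero K] {X : σ → Dual K V}
    {c : Set (Submodule K (Dual K V))} (hc : IsUpperSet c) {S A : Finset σ} {x : σ} (hx : x ∉ S)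
    (hX : X x ≠ 0) (hcS : spanOn X (insert x S) ∈ c) {f : SymmetricAlgebra K (Dual K V)}
    (hf : MemNormalKernel X c (insert x S) (ι K (Dual K V) (X x) * f)) (hA : A ⊆ S)
    (hr : finrank K (spanOn X A) + 1 = finrank K (spanOn X S)) :
    ∃ η, IsNormalOn X S (spanOn X A) η ∧
      (dirDerivHom K V η ^ (numNonzero X S η + ind c (spanOn X A))) f = 0 := by
  have hA' : A ⊆ insert x S := hA.trans (Finset.subset_insert x S)
  by_cases hxS : X x ∈ spanOn X S
  · obtain ⟨η, h1, h2⟩ := hf.hyperplane A hA' (by rw [hr, spanOn_insert_of_mem hxS])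
    exact ⟨η, h1.of_insert, dirDerivHom_pow_eq_zero_of_ι_mul_insert hx hX h2⟩
  have hxA : X x ∉ spanOn X A := fun h => hxS (spanOn_mono X hA h)
  -- Here X x is independent of S, so adjoining x to A adds no element of S to its flat; the normal
  -- of the larger hyperplane is a normal for A on S.
  obtain ⟨η, h1, h2⟩ := hf.hyperplane (insert x A) (Finset.insert_subset_insert x hA) (by
    rw [finrank_spanOn_insert hxA, finrank_spanOn_insert hxS, hr])
  have hη : IsNormalOn X S (spanOn X A) η := fun i hi => by
    rw [h1 i (Finset.mem_insert_of_mem hi), spanOn_insert]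
    refine ⟨fun h => ?_, fun h => Submodule.mem_sup_right h⟩
    obtain ⟨y, hy, w, hw, hyw⟩ := Submodule.mem_sup.1 h
    obtain ⟨a, rfl⟩ := Submodule.mem_span_singleton.1 hy
    have ha : a = 0 := by
      by_contra ha
      refine hxS ((Submodule.smul_mem_iff _ ha).1 ?_)
      rw [eq_sub_of_add_eq hyw]
      exact sub_mem (mem_spanOn X hi) (spanOn_mono X hA hw)
    rw [← hyw, ha, zero_smul, zero_add]
    exact hw
  by_cases hSc : spanOn X S ∈ c
  swap
  · have h0 := hf.perp_deletion hx hX hcS 0 fun i _ => map_zero _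
    rw [ind_of_notMem hSc, pow_zero, Module.End.one_apply] at h0
    exact ⟨η, hη, by rw [h0, map_zero]⟩
  by_cases hAc : ind c (spanOn X (insert x A)) = ind c (spanOn X A)
  · rw [hAc] at h2
    exact ⟨η, hη, dirDerivHom_pow_eq_zero_of_ι_mul_insert hx hX h2⟩
  · have hAm : spanOn X A ∉ c := fun h => hAc (by
      rw [ind_of_mem h, ind_of_mem (hc (spanOn_mono X (Finset.subset_insert x A)) h)])
    have hAx : spanOn X (insert x A) ∈ c := by
      by_contra h
      exact hAc (by rw [ind_of_notMem h, ind_of_notMem hAm])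
    -- A is now maximal missing in the larger family: a larger span either contains X x, hence the
    -- span of A and x, or comes from S and has the full rank of S.
    obtain ⟨η, h1, h2⟩ := hf.missing A hA' hAm (fun h => hAm (h ▸ hcS)) fun B hB hlt => by
      by_cases hxB : X x ∈ spanOn X B
      · refine hc ?_ hAx
        rw [spanOn_insert, sup_le_iff, Submodule.span_singleton_le_iff_mem]
        exact ⟨hxB, hlt.le⟩
      · have hBS : B ⊆ S := (Finset.subset_insert_iff_of_notMem fun h => hxB (mem_spanOn X h)).1 hB
        have hfin : FiniteDimensional K (spanOn X S) :=
          FiniteDimensional.span_of_finite K (Set.toFinite _)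
        have hfinB : FiniteDimensional K (spanOn X B) :=
          FiniteDimensional.span_of_finite K (Set.toFinite _)
        have hlt' := Submodule.finrank_lt_finrank_of_lt hlt
        rwa [Submodule.eq_of_le_of_finrank_le (spanOn_mono X hBS) (by omega)]
    refine ⟨η, h1.of_insert, ?_⟩
    rw [ind_of_notMem hAm]
    exact dirDerivHom_pow_eq_zero_of_ι_mul_insert (j := 0) hx hX h2

theorem MemNormalKernel.missing_deletion [CharZero K] {X : σ → Dual K V}
    {c : Set (Submodule K (Dual K V))} (hc : IsUpperSet c) {S A : Finset σ} {x : σ} (hx : x ∉ S)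
    (hX : X x ≠ 0) (hcS : spanOn X (insert x S) ∈ c) {f : SymmetricAlgebra K (Dual K V)}
    (hf : MemNormalKernel X c (insert x S) (ι K (Dual K V) (X x) * f)) (hA : A ⊆ S)
    (hAm : spanOn X A ∉ c) (hmax : ∀ B ⊆ S, spanOn X A < spanOn X B → spanOn X B ∈ c) :
    ∃ η, IsNormalOn X S (spanOn X A) η ∧ (dirDerivHom K V η ^ numNonzero X S η) f = 0 := by
  have hA' : A ⊆ insert x S := hA.trans (Finset.subset_insert x S)
  by_cases hall : ∀ B ⊆ insert x S, spanOn X A < spanOn X B → spanOn X B ∈ c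
  · obtain ⟨η, h1, h2⟩ := hf.missing A hA' hAm (fun h => hAm (h ▸ hcS)) hall
    exact ⟨η, h1.of_insert, dirDerivHom_pow_eq_zero_of_ι_mul_insert (j := 0) hx hX h2⟩
  -- Only the span of A and x can obstruct maximality after x is restored. It meets S in the same
  -- flat as A, so its normal serves for A.
  have key : ∀ B ⊆ insert x S, spanOn X A < spanOn X B → spanOn X B ∉ c →
      (∀ i ∈ S, X i ∈ spanOn X B → X i ∈ spanOn X A) ∧ spanOn X B = spanOn X (insert x A) := by
    intro B hB hlt hBc
    have hflat : ∀ i ∈ S, X i ∈ spanOn X B → X i ∈ spanOn X A := by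
      intro i hi hiB
      by_contra hiA
      have hle : spanOn X (insert i A) ≤ spanOn X B := by
        rw [spanOn_insert, sup_le_iff, Submodule.span_singleton_le_iff_mem]
        exact ⟨hiB, hlt.le⟩
      refine hBc (hc hle (hmax _ (Finset.insert_subset hi hA) (lt_of_le_of_ne
        (spanOn_mono X (Finset.subset_insert i A)) fun h => hiA ?_)))
      rw [h]
      exact mem_spanOn X (Finset.mem_insert_self i A)
    refine ⟨hflat, le_antisymm (spanOn_le.2 fun i hi => ?_) ?_⟩
    · rcases Finset.mem_insert.1 (hB hi) with rfl | hiS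
      · exact mem_spanOn X (Finset.mem_insert_self _ _)
      · exact spanOn_mono X (Finset.subset_insert x A) (hflat i hiS (mem_spanOn X hi))
    · have hxB : x ∈ B := by
        by_contra h
        exact hBc (hmax B ((Finset.subset_insert_iff_of_notMem h).1 hB) hlt)
      rw [spanOn_insert, sup_le_iff, Submodule.span_singleton_le_iff_mem]
      exact ⟨mem_spanOn X hxB, hlt.le⟩
  push Not at hall
  obtain ⟨B, hB, hlt, hBc⟩ := hall
  obtain ⟨hflat, hBA⟩ := key B hB hlt hBc
  rw [hBA] at hlt hBc hflat
  obtain ⟨η, h1, h2⟩ := hf.missing (insert x A) (Finset.insert_subset_insert x hA) hBc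
    (fun h => hBc (h ▸ hcS)) fun B' hB' hlt' => by
      by_contra hBc'
      exact hlt'.ne (key B' hB' (hlt.trans hlt') hBc').2.symm
  refine ⟨η, fun i hi => ?_, dirDerivHom_pow_eq_zero_of_ι_mul_insert (j := 0) hx hX h2⟩
  rw [h1 i (Finset.mem_insert_of_mem hi)]
  exact ⟨hflat i hi, fun h => spanOn_mono X (Finset.subset_insert x A) h⟩

/-- For `k = 0`, one normal vector for each hyperplane and each maximal missing flat suffices. -/
theorem MemNormalKernel.mem_powerSpan {K : Type*} [Field K] [CharZero K] {σ : Type*}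
    [DecidableEq σ] {S : Finset σ} {V : Type*} [AddCommGroup V] [Module K V]
    [FiniteDimensional K V] {X : σ → Dual K V} {c : Set (Submodule K (Dual K V))}
    (hc : IsUpperSet c) {f : SymmetricAlgebra K (Dual K V)} (hf : MemNormalKernel X c S f) :
    f ∈ powerSpan X c 0 S := by
  induction S using Finset.induction_on generalizing V with
  | empty =>
    refine mem_powerSpan_empty fun η => ?_
    simpa [spanOn_empty] using hf.perp η
  | insert x S hx ih =>
    by_cases hcS : spanOn X (insert x S) ∈ c
    swap
    · have h := hf.perp 0 fun i _ => map_zero _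
      rw [ind_of_notMem hcS, pow_zero, Module.End.one_apply] at h
      rw [h]
      exact zero_mem _
    by_cases h0 : X x = 0
    · exact powerSpan_le_insert_of_eq_zero hx h0 (ih hc (hf.of_insert_of_eq_zero h0))
    · obtain ⟨g, hg, h, rfl⟩ := exists_eq_add_ι_mul (c := c) (k := 0) (f := f) hx
        (ih (isUpperSet_contract _ hc) (hf.restr h0))
      have hf' := hf.of_add hc hg
      exact add_mem hg (ι_mul_mem_powerSpan hx (ih hc
        ⟨fun η => hf'.perp_deletion hx h0 hcS η,
          fun A hA hr => hf'.hyperplane_deletion hc hx h0 hcS hA hr,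
          fun A hA hm _ hmax => hf'.missing_deletion hc hx h0 hcS hA hm hmax⟩))

end NormalKernel

/-! ### The pairing between Sym(U) and Sym(V), and recovery of an ideal from its kernel. -/

section Duality

variable {K : Type*} [Field K] {V : Type*} [AddCommGroup V] [Module K V]

theorem diffOp_ι_pow (v : V) (n : ℕ) : diffOp K V (ι K V v ^ n) = dirDerivHom K V v ^ n := by
  rw [map_pow]
  congr 1
  exact LinearMap.ext fun f => diffOp_ι v f

theorem pairing_mul (f : SymmetricAlgebra K (Dual K V)) (p q : SymmetricAlgebra K V) :
    pairing f (p * q) = pairing (diffOp K V q f) p := by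
  rw [pairing, map_mul, Module.End.mul_apply, pairing]

variable (K V) in
/-- The pairing between `Sym(U)` and `Sym(V)` as a bilinear map. -/
noncomputable def pairingHom :
    SymmetricAlgebra K (Dual K V) →ₗ[K] SymmetricAlgebra K V →ₗ[K] K :=
  LinearMap.mk₂ K pairing
    (fun f g q => by rw [pairing, map_add, map_add]; rfl)
    (fun a f q => by rw [pairing, map_smul, map_smul]; rfl)
    (fun f p q => by rw [pairing, map_add, LinearMap.add_apply, map_add]; rfl)
    (fun a f q => by rw [pairing, map_smul, LinearMap.smul_apply, map_smul]; rfl)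

/-- Since ⟨f, q v⟩ = ⟨D_v f, q⟩, induction on degree makes all derivatives of f vanish. Then f is
constant, and pairing with 1 detects it. -/
theorem eq_zero_of_pairing_eq_zero [CharZero K] [FiniteDimensional K V]
    {f : SymmetricAlgebra K (Dual K V)} (hf : ∀ q, pairing f q = 0) : f = 0 := by
  obtain ⟨n, hn⟩ := exists_mem_symLT f
  induction n generalizing f with
  | zero => simpa [symLT_zero] using hn
  | succ n ih =>
    have h1 : ∀ v, dirDerivHom K V v f ∈ symLT K (Dual K V) 0 := fun v => by
      rw [symLT_zero, Submodule.mem_bot]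
      refine ih (fun q => ?_) (dirDerivHom_mem_symLT v hn)
      have h := hf (q * ι K V v)
      rwa [pairing_mul, diffOp_ι] at h
    have h2 := mem_symLT_of_dirDerivHom_mem h1
    rw [symLT_succ, symLT_zero, bot_sup_eq, pow_zero, Submodule.mem_one] at h2
    obtain ⟨a, rfl⟩ := h2
    have h3 := hf 1
    rw [pairing, map_one, Module.End.one_apply, AlgHom.commutes] at h3
    rw [show a = 0 from h3, map_zero]

theorem mem_kernel_span [CharZero K] [FiniteDimensional K V] {G : Set (SymmetricAlgebra K V)}
    {f : SymmetricAlgebra K (Dual K V)} :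
    f ∈ kernel (Ideal.span G) ↔ ∀ g ∈ G, diffOp K V g f = 0 := by
  constructor
  · intro hf g hg
    refine eq_zero_of_pairing_eq_zero fun q => ?_
    rw [← pairing_mul]
    exact hf _ (Ideal.mul_mem_left _ q (Ideal.subset_span hg))
  · intro hf q hq
    have h : diffOp K V q f = 0 := by
      refine Submodule.span_induction (p := fun q _ => diffOp K V q f = 0) hf ?_ ?_ ?_ hq
      · rw [map_zero, LinearMap.zero_apply]
      · intro p q _ _ hp hq
        rw [map_add, LinearMap.add_apply, hp, hq, add_zero]
      · intro a q _ hq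
        rw [smul_eq_mul, map_mul, Module.End.mul_apply, hq, map_zero]
    rw [pairing, h, map_zero]

theorem kernel_anti {I I' : Ideal (SymmetricAlgebra K V)} (h : I ≤ I') : kernel I' ≤ kernel I :=
  fun _ hf q hq => hf q (h hq)

theorem diffOp_eq_zero_of_mem_pow {n i : ℕ} (h : n ≤ i) {f : SymmetricAlgebra K (Dual K V)}
    (hf : f ∈ symLT K (Dual K V) n) {q : SymmetricAlgebra K V}
    (hq : q ∈ LinearMap.range (ι K V) ^ i) : diffOp K V q f = 0 := by
  induction i generalizing n f q with
  | zero =>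
    obtain rfl := Nat.le_zero.1 h
    rw [symLT_zero, Submodule.mem_bot] at hf
    rw [hf, map_zero]
  | succ i ih =>
    rw [pow_succ] at hq
    refine Submodule.mul_induction_on hq ?_ fun x y hx hy => by
      rw [map_add, LinearMap.add_apply, hx, hy, add_zero]
    rintro p hp _ ⟨v, rfl⟩
    rw [map_mul, Module.End.mul_apply, diffOp_ι]
    refine ih (n := n - 1) (by omega) (dirDerivHom_mem_symLT v (symLT_mono ?_ hf)) hp
    omega

theorem finiteDimensional_symLT {M : Type*} [AddCommGroup M] [Module K M] [FiniteDimensional K M]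
    (n : ℕ) : FiniteDimensional K (symLT K M n) := by
  have h : (symLT K M n).FG := by
    induction n with
    | zero => rw [symLT_zero]; exact Submodule.fg_bot
    | succ n ih =>
      rw [symLT_succ]
      refine ih.sup (Submodule.FG.pow ?_ n)
      rw [LinearMap.range_eq_map]
      exact Submodule.FG.map _ Module.Finite.fg_top
  exact Module.Finite.iff_fg.2 h

theorem finrank_symLT_eq {M M' : Type*} [AddCommGroup M] [Module K M] [AddCommGroup M']
    [Module K M'] (e : M ≃ₗ[K] M') (n : ℕ) :
    finrank K (symLT K M n) = finrank K (symLT K M' n) := by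
  let F : SymmetricAlgebra K M →ₐ[K] SymmetricAlgebra K M' :=
    SymmetricAlgebra.lift (ι K M' ∘ₗ e.toLinearMap)
  let G : SymmetricAlgebra K M' →ₐ[K] SymmetricAlgebra K M :=
    SymmetricAlgebra.lift (ι K M ∘ₗ e.symm.toLinearMap)
  have hGF : G.comp F = AlgHom.id K _ := by
    apply SymmetricAlgebra.algHom_ext
    ext u
    simp [F, G]
  have hF : Function.Injective F.toLinearMap := fun a b h => by
    have h' := congrArg G h
    rwa [← AlgHom.toLinearMap_apply G, ← AlgHom.toLinearMap_apply G, AlgHom.toLinearMap_apply,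
      AlgHom.toLinearMap_apply, AlgHom.toLinearMap_apply, AlgHom.toLinearMap_apply,
      ← AlgHom.comp_apply, ← AlgHom.comp_apply, hGF] at h'
  have hrange : (LinearMap.range (ι K M)).map F.toLinearMap = LinearMap.range (ι K M') := by
    rw [← LinearMap.range_comp]
    have h : F.toLinearMap ∘ₗ ι K M = ι K M' ∘ₗ e.toLinearMap := by
      ext u
      simp [F]
    rw [h, LinearMap.range_comp_of_range_eq_top _ e.range]
  have hmap : (symLT K M n).map F.toLinearMap = symLT K M' n := by
    simp only [symLT, Submodule.map_iSup, Submodule.map_pow, hrange]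
  rw [← hmap]
  exact (Submodule.equivMapOfInjective _ hF _).finrank_eq

/-- A linear functional on `Sym(V)` that vanishes in high degrees is given by pairing with an
element of `Sym(U)`. -/
theorem exists_pairing_eq [CharZero K] [FiniteDimensional K V] {n : ℕ}
    (φ : Dual K (SymmetricAlgebra K V))
    (hφ : ∀ i, n ≤ i → ∀ q ∈ LinearMap.range (ι K V) ^ i, φ q = 0) :
    ∃ f, ∀ q, pairing f q = φ q := by
  have hsplit : ∀ ψ : Dual K (SymmetricAlgebra K V), (∀ q ∈ symLT K V n, ψ q = 0) →
      (∀ i, n ≤ i → ∀ q ∈ LinearMap.range (ι K V) ^ i, ψ q = 0) → ∀ q, ψ q = 0 := by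
    intro ψ h1 h2 q
    obtain ⟨d, hd⟩ := exists_mem_symLT q
    suffices h : symLT K V d ≤ LinearMap.ker ψ from h hd
    refine iSup₂_le fun i _ p hp => ?_
    rcases Nat.lt_or_ge i n with hi | hi
    · exact h1 p (pow_range_le_symLT hi hp)
    · exact h2 i hi p hp
  have hhigh : ∀ f ∈ symLT K (Dual K V) n, ∀ i, n ≤ i → ∀ q ∈ LinearMap.range (ι K V) ^ i,
      pairing f q = 0 := fun f hf i hi q hq => by
    rw [pairing, diffOp_eq_zero_of_mem_pow hi hf hq, map_zero]
  -- Truncated below degree n, the pairing is injective between spaces of equal finite dimension, so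
  -- every functional is attained.
  let L : symLT K (Dual K V) n →ₗ[K] Dual K (symLT K V n) :=
    (symLT K V n).subtype.dualMap ∘ₗ pairingHom K V ∘ₗ (symLT K (Dual K V) n).subtype
  have hL : ∀ (f : symLT K (Dual K V) n) (q : symLT K V n),
      L f q = pairing (f : SymmetricAlgebra K (Dual K V)) q := fun _ _ => rfl
  have hinj : Function.Injective L := by
    rw [← LinearMap.ker_eq_bot, LinearMap.ker_eq_bot']
    intro f hf
    refine Subtype.ext (eq_zero_of_pairing_eq_zero
      (hsplit (pairingHom K V f) (fun q hq => ?_) (hhigh f f.2)))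
    exact LinearMap.congr_fun hf ⟨q, hq⟩
  have hfin := finiteDimensional_symLT (K := K) (M := V) n
  have hfin' := finiteDimensional_symLT (K := K) (M := Dual K V) n
  have hdim : finrank K (symLT K (Dual K V) n) = finrank K (Dual K (symLT K V n)) := by
    rw [Subspace.dual_finrank_eq]
    exact finrank_symLT_eq (finBasis K V).toDualEquiv.symm n
  obtain ⟨f, hf⟩ := (LinearMap.injective_iff_surjective_of_finrank_eq_finrank hdim).1 hinj
    ((symLT K V n).subtype.dualMap φ)
  refine ⟨f, fun q => sub_eq_zero.1 (hsplit (pairingHom K V f - φ) (fun q hq => ?_)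
    (fun i hi q hq => ?_) q)⟩
  · exact sub_eq_zero.2 (LinearMap.congr_fun hf ⟨q, hq⟩)
  · exact sub_eq_zero.2 ((hhigh f f.2 i hi q hq).trans (hφ i hi q hq).symm)

/-- An ideal containing a power of the irrelevant ideal is determined by its kernel. -/
theorem mem_of_forall_kernel_pairing_eq_zero [CharZero K] [FiniteDimensional K V]
    {I : Ideal (SymmetricAlgebra K V)} {n : ℕ}
    (hI : Ideal.span (Set.range (ι K V)) ^ n ≤ I) {q : SymmetricAlgebra K V}
    (hq : ∀ f ∈ kernel I, pairing f q = 0) : q ∈ I := by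
  by_contra hqI
  -- A functional separating q from I vanishes in degrees at least n, hence is pairing with some f;
  -- that f lies in the kernel of I.
  obtain ⟨φ, hφq, hφ⟩ := Submodule.exists_dual_map_eq_bot_of_notMem (p := I.restrictScalars K)
    (x := q) hqI inferInstance
  have hφI : ∀ p ∈ I, φ p = 0 := fun p hp => by
    have h : φ p ∈ (I.restrictScalars K).map φ := ⟨p, hp, rfl⟩
    rwa [hφ] at h
  have hpow : ∀ i, LinearMap.range (ι K V) ^ i ≤
      (Ideal.span (Set.range (ι K V)) ^ i).restrictScalars K := by
    intro i
    induction i with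
    | zero =>
      rw [pow_zero (Ideal.span _), Ideal.one_eq_top]
      exact fun _ _ => trivial
    | succ i ih =>
      rw [pow_succ, pow_succ, Submodule.mul_le]
      rintro a ha _ ⟨v, rfl⟩
      exact Ideal.mul_mem_mul (ih ha) (Ideal.subset_span ⟨v, rfl⟩)
  obtain ⟨f, hf⟩ := exists_pairing_eq (n := n) φ fun i hi p hp =>
    hφI p (hI (Ideal.pow_le_pow_right hi (hpow i hp)))
  exact hφq (by rw [← hf, hq f fun p hp => by rw [hf, hφI p hp]])

theorem le_of_kernel_le [CharZero K] [FiniteDimensional K V]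
    {I I' : Ideal (SymmetricAlgebra K V)} {n : ℕ}
    (hI : Ideal.span (Set.range (ι K V)) ^ n ≤ I) (h : kernel I ≤ kernel I') : I' ≤ I :=
  fun q hq => mem_of_forall_kernel_pairing_eq_zero hI fun _ hf => h hf q hq

end Duality

/-! ### From flats to subspaces, and the three claims for X. -/

section Translation

variable {K : Type*} [Field K] {V : Type*} [AddCommGroup V] [Module K V] {N : ℕ}
  {X : Fin N → Dual K V}

/-- The subspaces `W` of `U` for which the flat `{i | X i ∈ W}` belongs to `J`. -/
def subspaceSet (J : Set (Flat X)) : Set (Submodule K (Dual K V)) :=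
  {W | closFlat X (flatOn X Finset.univ W) ∈ J}

theorem subset_clos (A : Finset (Fin N)) : A ⊆ clos X A :=
  fun _ hi => (mem_clos X).2 (mem_spanOn X hi)

theorem clos_subset {A : Finset (Fin N)} {C : Flat X} (h : A ⊆ C.1) : clos X A ⊆ C.1 := by
  intro i hi
  rw [← C.2]
  exact (mem_clos X).2 (spanOn_mono X h ((mem_clos X).1 hi))

theorem closFlat_mono {A B : Finset (Fin N)} (h : A ⊆ B) : closFlat X A ≤ closFlat X B :=
  clos_subset (C := closFlat X B) (h.trans (subset_clos B))

theorem closFlat_val (C : Flat X) : closFlat X C.1 = C := Subtype.ext C.2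

theorem isUpperSet_subspaceSet {J : Set (Flat X)} (hJ : IsUpperSet J) :
    IsUpperSet (subspaceSet J) := by
  classical
  exact fun _ _ h hW => hJ (closFlat_mono (Finset.monotone_filter_right _ fun _ _ hi => h hi)) hW

theorem flatOn_univ_spanOn (A : Finset (Fin N)) : flatOn X Finset.univ (spanOn X A) = clos X A := by
  classical
  ext i
  rw [mem_clos, flatOn, Finset.mem_filter]
  exact and_iff_right (Finset.mem_univ i)

theorem spanOn_mem_subspaceSet {J : Set (Flat X)} {A : Finset (Fin N)} :
    spanOn X A ∈ subspaceSet J ↔ closFlat X A ∈ J := by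
  rw [subspaceSet, Set.mem_ofPred_eq, flatOn_univ_spanOn]
  exact iff_of_eq (congrArg (· ∈ J) (Subtype.ext (clos_clos X A)))

theorem ind_subspaceSet (J : Set (Flat X)) (A : Finset (Fin N)) :
    ind (subspaceSet J) (spanOn X A) = chi J (closFlat X A) := by
  by_cases h : closFlat X A ∈ J
  · rw [ind_of_mem (spanOn_mem_subspaceSet.2 h), chi, if_pos h]
  · rw [ind_of_notMem (spanOn_mem_subspaceSet.not.2 h), chi, if_neg h]

theorem m_zeroFlat (η : V) : m X (zeroFlat X η) = numNonzero X Finset.univ η := by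
  rw [m, numNonzero, zeroFlat]
  congr 1
  ext i
  simp

theorem zeroSet_univ (η : V) : zeroSet X Finset.univ η = (zeroFlat X η).1 := rfl

theorem mem_zeroFlat {η : V} {i : Fin N} : i ∈ (zeroFlat X η).1 ↔ X i η = 0 := by
  simp [zeroFlat]

theorem m_pos {C : Flat X} (hC : C.1 ≠ Finset.univ) : 0 < m X C := by
  rw [m, Finset.card_pos, Finset.sdiff_nonempty]
  exact fun h => hC (Finset.univ_subset_iff.1 h)

theorem chi_le_one (J : Set (Flat X)) (C : Flat X) : chi J C ≤ 1 := by
  rw [chi]; split_ifs <;> omega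

theorem mem_of_univ_eq {J : Set (Flat X)} (hJ : J.Nonempty) (hJup : IsUpperSet J) {C : Flat X}
    (hC : C.1 = Finset.univ) : C ∈ J := by
  obtain ⟨D, hD⟩ := hJ
  exact hJup (show D.1 ⊆ C.1 from hC ▸ Finset.subset_univ _) hD

theorem expo_natCast (n : ℕ) (J : Set (Flat X)) (C : Flat X) :
    expo X n J C = m X C + n + chi J C := by
  rw [expo]; omega

theorem expo_zeroFlat (n : ℕ) (J : Set (Flat X)) (η : V) :
    expo X n J (zeroFlat X η) = numNonzero X Finset.univ η + n +
      ind (subspaceSet J) (spanOn X (zeroSet X Finset.univ η)) := by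
  rw [expo_natCast, m_zeroFlat, zeroSet_univ, ind_subspaceSet, closFlat_val]

/-- The strict bound deg f < n + χ covers both cases of `genS`: for n = 0 it leaves scalars when χ =
1 and only f = 0 when χ = 0. -/
theorem pSpace_natCast (n : ℕ) (J : Set (Flat X)) :
    pSpace X n J = powerSpan X (subspaceSet J) n Finset.univ := by
  have hn1 : (n : ℤ) ≠ -1 := by omega
  refine le_antisymm (Submodule.span_le.2 ?_) (Submodule.span_le.2 ?_)
  · intro g hg
    rw [genS, if_neg hn1] at hg
    split_ifs at hg with hn0
    · obtain ⟨Y, hY, rfl⟩ := hg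
      have h := mul_prodOn_mem_powerSpan (X := X) (c := subspaceSet J) (k := n) (f := 1)
        (Finset.subset_univ Y) (by
          rw [ind_of_mem (spanOn_mem_subspaceSet.2 hY)]
          refine pow_range_le_symLT (i := 0) (by omega) ?_
          rw [pow_zero]
          exact Submodule.one_le.1 le_rfl)
      rwa [one_mul] at h
    · obtain ⟨Y, f, _, ⟨d, hd, hf⟩, rfl⟩ := hg
      refine mul_prodOn_mem_powerSpan (Finset.subset_univ Y) ?_
      rw [degLE_eq] at hf
      refine symLT_mono ?_ hf
      rw [ind_subspaceSet]
      omega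
  · rintro _ ⟨Y, _, f, hf, rfl⟩
    rw [ind_subspaceSet] at hf
    change f * pProd X Y ∈ pSpace X n J
    rcases Nat.eq_zero_or_pos n with rfl | hn
    · by_cases hY : closFlat X (Finset.univ \ Y) ∈ J
      · rw [chi, if_pos hY, symLT_succ, symLT_zero, bot_sup_eq, pow_zero, Submodule.mem_one] at hf
        obtain ⟨a, rfl⟩ := hf
        rw [← Algebra.smul_def]
        refine Submodule.smul_mem _ _ (Submodule.subset_span ?_)
        rw [genS, if_neg (by norm_num), if_pos (by norm_num)]
        exact ⟨Y, hY, rfl⟩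
      · rw [chi, if_neg hY, symLT_zero, Submodule.mem_bot] at hf
        rw [hf, zero_mul]
        exact zero_mem _
    · by_cases hf0 : f = 0
      · rw [hf0, zero_mul]
        exact zero_mem _
      refine Submodule.subset_span ?_
      rw [genS, if_neg hn1, if_neg (by omega)]
      refine ⟨Y, f, hf0, ⟨n + chi J (closFlat X (Finset.univ \ Y)) - 1, by omega, ?_⟩, rfl⟩
      rw [degLE_eq, Nat.sub_add_cancel (by omega)]
      exact hf

theorem spanOn_univ (hX : Submodule.span K (Set.range X) = ⊤) : spanOn X Finset.univ = ⊤ := by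
  rw [spanOn, Finset.coe_univ, Set.image_univ, hX]

theorem IsMaximalMissing.ne_univ {J : Set (Flat X)} (hJ : J.Nonempty)
    (hJup : IsUpperSet J) {C : Flat X} (hC : IsMaximalMissing J C) : C.1 ≠ Finset.univ :=
  fun h => hC.1 (mem_of_univ_eq hJ hJup h)

theorem isNormalOn_closFlat {E : Flat X → V} (hE : IsNormalSelector X E) (A : Finset (Fin N)) :
    IsNormalOn X Finset.univ (spanOn X A) (E (closFlat X A)) := by
  intro i _
  rw [← mem_zeroFlat, hE]
  exact mem_clos X

theorem spanOn_clos (A : Finset (Fin N)) : spanOn X (clos X A) = spanOn X A :=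
  le_antisymm (spanOn_le.2 fun _ hi => (mem_clos X).1 hi) (spanOn_mono X (subset_clos A))

theorem eq_zero_of_forall_apply_eq_zero (hX : Submodule.span K (Set.range X) = ⊤) {η : V}
    (h : ∀ i, X i η = 0) : η = 0 := by
  rw [← forall_dual_apply_eq_zero_iff K]
  intro u
  refine apply_eq_zero_of_mem_spanOn (X := X) (A := Finset.univ) (fun i _ => h i) ?_
  rw [spanOn_univ hX]
  trivial

theorem IsHyperplane.ne_univ (hX : Submodule.span K (Set.range X) = ⊤) {C : Flat X}
    (hC : IsHyperplane X C) : C.1 ≠ Finset.univ := by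
  intro h
  rw [IsHyperplane, h] at hC
  have h1 : rank X Finset.univ = finrank K (Dual K V) := by
    rw [← finrank_top K (Dual K V), ← spanOn_univ hX]
    rfl
  omega

variable (X) in
/-- The upper set consisting of the flat `X` only. -/
def topSet : Set (Flat X) := {C | C.1 = Finset.univ}

theorem topSet_nonempty : (topSet X).Nonempty :=
  ⟨closFlat X Finset.univ, Finset.univ_subset_iff.1 (subset_clos _)⟩

theorem isUpperSet_topSet : IsUpperSet (topSet X) :=
  fun _ _ h hC => Finset.univ_subset_iff.1 (hC.symm.subset.trans h)

theorem spanOn_eq_top_iff (hX : Submodule.span K (Set.range X) = ⊤) {C : Flat X} :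
    spanOn X C.1 = ⊤ ↔ C.1 = Finset.univ := by
  constructor
  · intro h
    rw [← C.2]
    refine Finset.eq_univ_iff_forall.2 fun i => (mem_clos X).2 ?_
    change X i ∈ spanOn X C.1
    rw [h]
    trivial
  · intro h
    rw [h, spanOn_univ hX]

theorem isHyperplane_of_spanOn_insert {C : Flat X} {i : Fin N} (hC : spanOn X C.1 ≠ ⊤)
    (h : spanOn X (insert i C.1) = ⊤) : IsHyperplane X C := by
  have hi : X i ∉ spanOn X C.1 := fun hi => hC (by rw [← h, spanOn_insert_of_mem hi])
  have h1 := finrank_spanOn_insert hi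
  rw [h, finrank_top] at h1
  exact h1.symm

theorem IsMaximalMissing.isHyperplane (hX : Submodule.span K (Set.range X) = ⊤) {C : Flat X}
    (hC : IsMaximalMissing (topSet X) C) : IsHyperplane X C := by
  have hCu : C.1 ≠ Finset.univ := hC.1
  obtain ⟨i, hi⟩ : ∃ i, i ∉ C.1 := by
    by_contra! h
    exact hCu (Finset.eq_univ_iff_forall.2 h)
  refine isHyperplane_of_spanOn_insert ((spanOn_eq_top_iff hX).not.2 hCu) (i := i) ?_
  rw [← spanOn_clos]
  refine (spanOn_eq_top_iff hX (C := closFlat X (insert i C.1))).2 ?_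
  by_contra h
  have hsub : insert i C.1 ⊆ (closFlat X (insert i C.1)).1 := subset_clos _
  exact hi (hC.2 (y := closFlat X (insert i C.1)) h ((Finset.subset_insert i C.1).trans hsub)
    (hsub (Finset.mem_insert_self i C.1)))

theorem powerIdeal'_le_powerIdeal (hX : Submodule.span K (Set.range X) = ⊤) (k : ℤ)
    {J : Set (Flat X)} (hJ : J.Nonempty) (hJup : IsUpperSet J) {E : Flat X → V}
    (hE : IsNormalSelector X E) : powerIdeal' X k J E ≤ powerIdeal X k J := by
  refine Ideal.span_le.2 ?_
  rintro _ ⟨C, hC, rfl⟩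
  refine Ideal.subset_span ⟨E C, fun h => ?_, by rw [hE C]⟩
  have h1 : C.1 = Finset.univ := by
    rw [← hE C, h]
    ext i
    simp [mem_zeroFlat]
  exact hC.elim (fun h => h.ne_univ hX h1) fun h => h.ne_univ hJ hJup h1

/-- For the upper set {X} the maximal missing flats are hyperplanes. At a hyperplane, which lies in
J, the exponents m + 0 + 0 and m - 1 + 1 coincide. -/
theorem powerIdeal'_topSet_le (hX : Submodule.span K (Set.range X) = ⊤) {J : Set (Flat X)}
    (hHyp : ∀ C : Flat X, IsHyperplane X C → C ∈ J) (E : Flat X → V) :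
    powerIdeal' X 0 (topSet X) E ≤ powerIdeal' X (-1) J E := by
  refine Ideal.span_mono ?_
  rintro _ ⟨C, hC, rfl⟩
  have hC' : IsHyperplane X C := hC.elim id fun h => h.isHyperplane hX
  refine ⟨C, Or.inl hC', ?_⟩
  rw [expo, expo, chi, chi, if_pos (hHyp C hC'),
    if_neg (show C ∉ topSet X from hC'.ne_univ hX)]
  congr 1
  omega

/-- Here X ∖ Y spans, so it has an element outside every proper flat C, and at least two unless C is
a hyperplane. As hyperplanes lie in J, these counts give the inequalities required for k = -1. -/
theorem pSpace_topSet_le (hX : Submodule.span K (Set.range X) = ⊤) {J : Set (Flat X)}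
    (hHyp : ∀ C : Flat X, IsHyperplane X C → C ∈ J) :
    pSpace X 0 (topSet X) ≤ pSpace X (-1) J := by
  refine Submodule.span_mono fun g hg => ?_
  rw [genS, if_neg (by norm_num), if_pos rfl] at hg
  rw [genS, if_pos rfl]
  obtain ⟨Y, hY, rfl⟩ := hg
  refine ⟨Y, fun C hC => ?_, rfl⟩
  have hYtop : spanOn X (Finset.univ \ Y) = ⊤ := by
    rw [← spanOn_clos]
    exact (spanOn_eq_top_iff hX (C := closFlat X (Finset.univ \ Y))).2 hY
  have hCtop : spanOn X C.1 ≠ ⊤ := (spanOn_eq_top_iff hX).not.2 hC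
  have hcard : m X C = (Y \ C.1).card + ((Finset.univ \ Y) \ C.1).card := by
    rw [m, ← Finset.card_union_of_disjoint]
    · congr 1
      ext i
      simp only [Finset.mem_sdiff, Finset.mem_univ, true_and, Finset.mem_union]
      tauto
    · rw [Finset.disjoint_left]
      intro i hi hi'
      simp only [Finset.mem_sdiff, Finset.mem_univ, true_and] at hi hi'
      exact hi'.1 hi.1
  have hpos : ((Finset.univ \ Y) \ C.1).card ≠ 0 := by
    rw [Ne, Finset.card_eq_zero, Finset.sdiff_eq_empty_iff_subset]
    exact fun h => hCtop (top_le_iff.1 (hYtop ▸ spanOn_mono X h))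
  by_cases hCJ : C ∈ J
  · rw [chi, if_pos hCJ]
    omega
  · have hne : ((Finset.univ \ Y) \ C.1).card ≠ 1 := by
      rw [Ne, Finset.card_eq_one]
      rintro ⟨i, hi⟩
      refine hCJ (hHyp C (isHyperplane_of_spanOn_insert hCtop (i := i) (top_le_iff.1 ?_)))
      rw [← hYtop]
      refine spanOn_mono X fun j hj => ?_
      rw [Finset.mem_insert]
      by_cases hjC : j ∈ C.1
      · exact Or.inr hjC
      · left
        rw [← Finset.mem_singleton, ← hi]
        exact Finset.mem_sdiff.2 ⟨hj, hjC⟩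
    rw [chi, if_neg hCJ]
    omega

variable [CharZero K] [FiniteDimensional K V]

theorem mem_kernel_powerIdeal {k : ℤ} {J : Set (Flat X)} {f : SymmetricAlgebra K (Dual K V)} :
    f ∈ kernel (powerIdeal X k J) ↔
      ∀ η ≠ 0, (dirDerivHom K V η ^ expo X k J (zeroFlat X η)) f = 0 := by
  rw [powerIdeal, mem_kernel_span]
  constructor
  · intro h η hη
    rw [← diffOp_ι_pow]
    exact h _ ⟨η, hη, rfl⟩
  · rintro h _ ⟨η, hη, rfl⟩
    rw [diffOp_ι_pow]
    exact h η hη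

theorem mem_kernel_powerIdeal' {k : ℤ} {J : Set (Flat X)} {E : Flat X → V}
    {f : SymmetricAlgebra K (Dual K V)} :
    f ∈ kernel (powerIdeal' X k J E) ↔
      ∀ C, (IsHyperplane X C ∨ IsMaximalMissing J C) →
        (dirDerivHom K V (E C) ^ expo X k J C) f = 0 := by
  rw [powerIdeal', mem_kernel_span]
  constructor
  · intro h C hC
    rw [← diffOp_ι_pow]
    exact h _ ⟨C, hC, rfl⟩
  · rintro h _ ⟨C, hC, rfl⟩
    rw [diffOp_ι_pow]
    exact h C hC

theorem pSpace_eq_kernel_of_natCast (n : ℕ) {J : Set (Flat X)} (hJ : J.Nonempty)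
    (hJup : IsUpperSet J) : pSpace X n J = kernel (powerIdeal X n J) := by
  rw [pSpace_natCast]
  ext f
  rw [mem_kernel_powerIdeal]
  constructor
  · intro hf η _
    rw [expo_zeroFlat]
    exact dirDerivHom_pow_eq_zero_of_mem_powerSpan (isUpperSet_subspaceSet hJup) hf η
  · intro hf
    refine mem_powerSpan_of_dirDerivHom_pow_eq_zero n _ (isUpperSet_subspaceSet hJup) fun η => ?_
    rw [← expo_zeroFlat]
    by_cases hη : η = 0
    · have h0 : zeroFlat X η ∈ J := mem_of_univ_eq hJ hJup (by
        ext i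
        simp [mem_zeroFlat, hη])
      have h1 : expo X n J (zeroFlat X η) ≠ 0 := by
        rw [expo_natCast, chi, if_pos h0]
        omega
      rw [hη, map_zero, zero_pow (hη ▸ h1), LinearMap.zero_apply]
    · exact hf η hη

theorem kernel_powerIdeal'_zero_le (hX : Submodule.span K (Set.range X) = ⊤)
    {J : Set (Flat X)} (hJ : J.Nonempty) (hJup : IsUpperSet J) {E : Flat X → V}
    (hE : IsNormalSelector X E) :
    kernel (powerIdeal' X 0 J E) ≤ kernel (powerIdeal X 0 J) := by
  have h := pSpace_eq_kernel_of_natCast 0 hJ hJup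
  rw [pSpace_natCast, Nat.cast_zero] at h
  rw [← h]
  intro f hf
  rw [mem_kernel_powerIdeal'] at hf
  have hexpo : ∀ C, expo X 0 J C = m X C + chi J C := fun C => expo_natCast 0 J C
  have hm : ∀ A, m X (closFlat X A) = numNonzero X Finset.univ (E (closFlat X A)) := fun A => by
    rw [← m_zeroFlat, hE]
  refine MemNormalKernel.mem_powerSpan (isUpperSet_subspaceSet hJup)
    ⟨fun η hη => ?_, fun A _ hr => ?_, fun A _ hm' hne hmax => ?_⟩
  · rw [eq_zero_of_forall_apply_eq_zero hX fun i => hη i (Finset.mem_univ i), map_zero,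
      ind_subspaceSet, chi, if_pos, pow_one, LinearMap.zero_apply]
    exact mem_of_univ_eq hJ hJup (Finset.univ_subset_iff.1 (subset_clos _))
  · refine ⟨E (closFlat X A), isNormalOn_closFlat hE A, ?_⟩
    rw [← hm, ind_subspaceSet, ← hexpo]
    refine hf _ (Or.inl ?_)
    rw [spanOn_univ hX, finrank_top] at hr
    rw [IsHyperplane, ← hr, ← spanOn_clos]
    rfl
  · refine ⟨E (closFlat X A), isNormalOn_closFlat hE A, ?_⟩
    rw [spanOn_mem_subspaceSet] at hm'
    have h1 := hf (closFlat X A) (Or.inr ⟨hm', fun D hD hle => ?_⟩)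
    · rwa [hexpo, chi, if_neg hm', add_zero, hm] at h1
    · by_contra hDA
      refine hD ?_
      have hlt : spanOn X A < spanOn X D.1 := by
        refine lt_of_le_of_ne (spanOn_mono X ((subset_clos A).trans hle)) fun h => hDA ?_
        intro i hi
        refine (mem_clos X).2 ?_
        change X i ∈ spanOn X A
        rw [h]
        exact mem_spanOn X hi
      have h2 := hmax D.1 (Finset.subset_univ _) hlt
      rwa [spanOn_mem_subspaceSet, closFlat_val] at h2

/-! ### The case `k = -1` -/

theorem kernel_powerIdeal_neg_one_le (J : Set (Flat X)) :
    kernel (powerIdeal X (-1) J) ≤ kernel (powerIdeal X 0 (topSet X)) := by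
  intro f hf
  rw [mem_kernel_powerIdeal] at hf ⊢
  intro η hη
  refine pow_apply_eq_zero_of_le ?_ (hf η hη)
  have h1 := chi_le_one J (zeroFlat X η)
  rw [expo, expo]
  omega

theorem pSpace_neg_one_le (hX : Submodule.span K (Set.range X) = ⊤) (J : Set (Flat X)) :
    pSpace X (-1) J ≤ kernel (powerIdeal X (-1) J) := by
  refine Submodule.span_le.2 fun g hg => ?_
  rw [genS, if_pos rfl] at hg
  obtain ⟨Y, hY, rfl⟩ := hg
  rw [SetLike.mem_coe, mem_kernel_powerIdeal]
  intro η hη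
  have hne : (zeroFlat X η).1 ≠ Finset.univ := fun h =>
    hη (eq_zero_of_forall_apply_eq_zero hX fun i => mem_zeroFlat.1 (h ▸ Finset.mem_univ i))
  have h1 := hY _ hne
  have h2 : (Y \ (zeroFlat X η).1).card = numNonzero X Y η := by
    rw [numNonzero]
    congr 1
    ext i
    simp [mem_zeroFlat]
  have h3 := dirDerivHom_pow_mul_prodOn X η (a := 1) Y (f := 1) (by
    rw [pow_one, ← map_one (algebraMap K _), dirDerivHom_algebraMap])
  rw [one_mul] at h3
  refine pow_apply_eq_zero_of_le ?_ h3
  rw [expo]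
  omega

theorem pSpace_neg_one_eq (hX : Submodule.span K (Set.range X) = ⊤) {J : Set (Flat X)}
    (hHyp : ∀ C : Flat X, IsHyperplane X C → C ∈ J) :
    pSpace X (-1) J = kernel (powerIdeal X (-1) J) ∧
      pSpace X (-1) J = kernel (powerIdeal X 0 (topSet X)) := by
  have h := pSpace_eq_kernel_of_natCast 0 (topSet_nonempty (X := X)) isUpperSet_topSet
  rw [Nat.cast_zero] at h
  have h1 := pSpace_topSet_le hX hHyp
  have h2 := pSpace_neg_one_le hX J
  have h3 := kernel_powerIdeal_neg_one_le J
  rw [h] at h1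
  exact ⟨le_antisymm h2 (h3.trans h1), le_antisymm (h2.trans h3) h1⟩

theorem kernel_powerIdeal_eq (hX : Submodule.span K (Set.range X) = ⊤) {k : ℤ}
    (hk : k = -1 ∨ k = 0) {J : Set (Flat X)} (hJ : J.Nonempty) (hJup : IsUpperSet J)
    (hHyp : k = -1 → ∀ C : Flat X, IsHyperplane X C → C ∈ J) {E : Flat X → V}
    (hE : IsNormalSelector X E) :
    kernel (powerIdeal X k J) = kernel (powerIdeal' X k J E) := by
  refine le_antisymm (kernel_anti (powerIdeal'_le_powerIdeal hX k hJ hJup hE)) ?_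
  rcases hk with rfl | rfl
  · obtain ⟨h1, h2⟩ := pSpace_neg_one_eq hX (hHyp rfl)
    rw [← h1, h2]
    exact (kernel_anti (powerIdeal'_topSet_le hX (hHyp rfl) E)).trans
      (kernel_powerIdeal'_zero_le hX topSet_nonempty isUpperSet_topSet hE)
  · exact kernel_powerIdeal'_zero_le hX hJ hJup hE

/-! ### Independence of the normal selector -/

/-- If a non-zero form u vanished on all hyperplane normals, every power of u would lie in ker
I'(X,0,{X},E) ⊆ ker I(X,0,{X}). But with u(η) ≠ 0 the power D_η^n does not kill u^n. -/
theorem span_hyperplane_normals (hX : Submodule.span K (Set.range X) = ⊤) {E : Flat X → V}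
    (hE : IsNormalSelector X E) : Submodule.span K {v | ∃ C, IsHyperplane X C ∧ v = E C} = ⊤ := by
  by_contra hne
  obtain ⟨u, hu0, hu⟩ := Submodule.exists_le_ker_of_lt_top _ (lt_top_iff_ne_top.2 hne)
  obtain ⟨η, hη⟩ : ∃ η, u η ≠ 0 := by
    by_contra! h
    exact hu0 (LinearMap.ext h)
  have hpow : ∀ v, u v = 0 → ∀ n, dirDerivHom K V v (ι K (Dual K V) u ^ n) = 0 := by
    intro v hv n
    induction n with
    | zero => rw [pow_zero, ← map_one (algebraMap K _), dirDerivHom_algebraMap]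
    | succ n ih => rw [pow_succ', dirDerivHom_ι_mul, ih, hv, mul_zero, zero_smul, add_zero]
  have hmem : ∀ n, ι K (Dual K V) u ^ n ∈ kernel (powerIdeal X 0 (topSet X)) := fun n => by
    refine kernel_powerIdeal'_zero_le hX topSet_nonempty isUpperSet_topSet hE ?_
    rw [mem_kernel_powerIdeal']
    intro C hC
    have hC' : IsHyperplane X C := hC.elim id fun h => h.isHyperplane hX
    refine pow_apply_eq_zero_of_le (m := 1) ?_ ?_
    · have h1 := expo_natCast 0 (topSet X) C
      rw [Nat.cast_zero] at h1
      have h2 := m_pos (hC'.ne_univ hX)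
      omega
    · rw [pow_one]
      exact hpow _ (hu (Submodule.subset_span ⟨C, hC', rfl⟩)) n
  have hη0 : η ≠ 0 := fun h => hη (by rw [h, map_zero])
  have hdesc : ∀ n, (dirDerivHom K V η ^ n) (ι K (Dual K V) u ^ n) ≠ 0 := by
    intro n
    induction n with
    | zero => simp
    | succ n ih =>
      intro h
      rw [pow_succ' (ι K (Dual K V) u)] at h
      exact ih (dirDerivHom_pow_eq_zero_of_ι_mul hη h)
  exact hdesc _ (mem_kernel_powerIdeal.1 (hmem _) η hη0)

/-- Some power of each hyperplane normal is a generator, so the radical contains these normals and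
hence all of V. The irrelevant ideal is finitely generated, so some power of it lies in the ideal.
-/
theorem exists_pow_le_powerIdeal' (hX : Submodule.span K (Set.range X) = ⊤) (k : ℤ)
    (J : Set (Flat X)) {E : Flat X → V} (hE : IsNormalSelector X E) :
    ∃ n : ℕ, Ideal.span (Set.range (ι K V)) ^ n ≤ powerIdeal' X k J E := by
  refine Ideal.exists_pow_le_of_le_radical_of_fg ?_ ?_
  · have h : Submodule.span K {v | ∃ C, IsHyperplane X C ∧ v = E C} ≤
        ((powerIdeal' X k J E).radical.restrictScalars K).comap (ι K V) := by
      refine Submodule.span_le.2 ?_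
      rintro _ ⟨C, hC, rfl⟩
      exact ⟨_, Ideal.subset_span ⟨C, Or.inl hC, rfl⟩⟩
    rw [span_hyperplane_normals hX hE] at h
    refine Ideal.span_le.2 ?_
    rintro _ ⟨v, rfl⟩
    exact h (Submodule.mem_top (x := v))
  · have hnoeth : IsNoetherianRing (SymmetricAlgebra K V) :=
      isNoetherianRing_of_ringEquiv _ (equivMvPolynomial (finBasis K V)).symm.toRingEquiv
    exact IsNoetherian.noetherian _

theorem powerIdeal'_eq (hX : Submodule.span K (Set.range X) = ⊤) {k : ℤ}
    (hk : k = -1 ∨ k = 0) {J : Set (Flat X)} (hJ : J.Nonempty) (hJup : IsUpperSet J)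
    (hHyp : k = -1 → ∀ C : Flat X, IsHyperplane X C → C ∈ J) {E E' : Flat X → V}
    (hE : IsNormalSelector X E) (hE' : IsNormalSelector X E') :
    powerIdeal' X k J E = powerIdeal' X k J E' := by
  have h := (kernel_powerIdeal_eq hX hk hJ hJup hHyp hE).symm.trans
    (kernel_powerIdeal_eq hX hk hJ hJup hHyp hE')
  obtain ⟨n, hn⟩ := exists_pow_le_powerIdeal' hX k J hE
  obtain ⟨n', hn'⟩ := exists_pow_le_powerIdeal' hX k J hE'
  exact le_antisymm (le_of_kernel_le hn' h.ge) (le_of_kernel_le hn h.le)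

end Translation

end Zonotopal

theorem mainTheorem1 {K : Type*} [Field K] [CharZero K]
    {V : Type*} [AddCommGroup V] [Module K V] [FiniteDimensional K V]
    (hr : 1 ≤ Module.finrank K V)
    {N : ℕ} (X : Fin N → Module.Dual K V)
    (hX : Submodule.span K (Set.range X) = ⊤)
    (k : ℤ) (hk : -1 ≤ k)
    (J : Set (Zonotopal.Flat X)) (hJ : J.Nonempty) (hJup : IsUpperSet J)
    (hHyp : k = -1 → ∀ C : Zonotopal.Flat X, Zonotopal.IsHyperplane X C → C ∈ J) :
    Zonotopal.pSpace X k J = Zonotopal.kernel (Zonotopal.powerIdeal X k J) ∧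
    (∀ E : Zonotopal.Flat X → V, Zonotopal.IsNormalSelector X E →
      Zonotopal.kernel (Zonotopal.powerIdeal X k J) ≤
        Zonotopal.kernel (Zonotopal.powerIdeal' X k J E)) ∧
    (k = -1 ∨ k = 0 →
      (∀ E E' : Zonotopal.Flat X → V,
        Zonotopal.IsNormalSelector X E → Zonotopal.IsNormalSelector X E' →
        Zonotopal.powerIdeal' X k J E = Zonotopal.powerIdeal' X k J E') ∧
      (∀ E : Zonotopal.Flat X → V, Zonotopal.IsNormalSelector X E →
        Zonotopal.kernel (Zonotopal.powerIdeal X k J) =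
          Zonotopal.kernel (Zonotopal.powerIdeal' X k J E))) := by
  refine ⟨?_, fun E hE => Zonotopal.kernel_anti
      (Zonotopal.powerIdeal'_le_powerIdeal hX k hJ hJup hE), fun hk0 =>
    ⟨fun E E' hE hE' => Zonotopal.powerIdeal'_eq hX hk0 hJ hJup hHyp hE hE',
      fun E hE => Zonotopal.kernel_powerIdeal_eq hX hk0 hJ hJup hHyp hE⟩⟩
  by_cases hk1 : k = -1
  · subst hk1
    exact (Zonotopal.pSpace_neg_one_eq hX (hHyp rfl)).1
  · obtain ⟨n, rfl⟩ := Int.eq_ofNat_of_zero_le (show 0 ≤ k by omega)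
    exact Zonotopal.pSpace_eq_kernel_of_natCast n hJ hJup
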